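/- Let $k$ be an algebraically closed field of infinite transcendence degree over its prime field. A variety over $k$ means a reduced separated scheme of finite type over $k$ (not necessarily irreducible). Two schemes over a base $S$ are birational over $S$ if they have dense open subschemes that are isomorphic over $S$. Let $B$ be an integral variety over $k$, and let $g : U \to B$ be a family of algebraic varieties, that is, a separated morphism of finite type such that for every closed point $b \in B$ the scheme-theoretic fiber $U_b$ is a variety over $k$; neither projectivity, properness nor flatness of $g$ is assumed. Suppose that the fibers $U_b$, for $b$ a closed point of $B$, are all birational to each other over $k$. Then $g$ is birationally isotrivial. Precisely, for every variety $X_0$ over $k$ that is birational over $k$ to the fibers of $g$ over closed points: (1) there are a dense open subset $B^0 \subset B$, an integral scheme $B'$ and a finite surjective morphism $B' \to B^0$ such that $U \times_B B'$ is birational to $B' \times_k X_0$ over $B'$; and (2) if $K = k(B)$ is the function field of $B$ and $\overline{K}$ is an algebraic closure of $K$, then the geometric generic fiber $U \times_B \operatorname{Spec} \overline{K}$ is birational over $\overline{K}$ to $X_0 \times_k \operatorname{Spec}\overline{K}$. -/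

import Mathlib

universe u

open CategoryTheory Limits AlgebraicGeometry

noncomputable section

namespace BirIsotrivial

/-- An algebraic variety over the field `k`: a reduced and separated scheme of finite type over `k`.
(It is not required to be irreducible.) -/
structure IsVariety {k : Type u} [Field k] {X : Scheme.{u}} (s : X ⟶ Spec (.of k)) : Prop where
  reduced : IsReduced X
  separated : IsSeparated s
  locallyOfFiniteType : LocallyOfFiniteType s
  quasiCompact : QuasiCompact s

/-- The structure morphism to `Spec k` of the scheme-theoretic fiber of `g : U ⟶ B` at the
point `b` of the `k`-scheme `B`. -/
def fiberStr {k : Type u} [Field k] {U B : Scheme.{u}} (sB : B ⟶ Spec (.of k)) (g : U ⟶ B)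
    (b : B) : g.fiber b ⟶ Spec (.of k) :=
  g.fiberι b ≫ g ≫ sB

/-- A family of algebraic varieties over the `k`-scheme `B`: a separated morphism of finite type
whose scheme-theoretic fibers at the closed points of `B` are varieties over `k`.
Neither properness nor flatness is required. -/
structure IsFamilyOfVarieties {k : Type u} [Field k] {U B : Scheme.{u}} (sB : B ⟶ Spec (.of k))
    (g : U ⟶ B) : Prop where
  separated : IsSeparated g
  locallyOfFiniteType : LocallyOfFiniteType g
  quasiCompact : QuasiCompact g
  fiber_isVariety : ∀ b : B, IsClosed {b} → IsVariety (fiberStr sB g b)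

/-- After base change along a finite cover `π : B' ⟶ B₀` (finite and surjective, `B'` integral)
of a dense open `B₀ ⊆ B`, the family `g` becomes birational, over `B'`, to `B' × X₀`. -/
def BirTrivialAfterFiniteCover {k : Type u} [Field k] {U B X₀ : Scheme.{u}}
    (sB : B ⟶ Spec (.of k)) (g : U ⟶ B) (s₀ : X₀ ⟶ Spec (.of k)) : Prop :=
  ∃ (B₀ : B.Opens) (B' : Scheme.{u}) (π : B' ⟶ B₀.toScheme),
    Dense (B₀ : Set B) ∧ IsIntegral B' ∧ IsFinite π ∧ Surjective π ∧
      Scheme.BirationalOver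
        (pullback.snd g (π ≫ B₀.ι))
        (pullback.fst (π ≫ B₀.ι ≫ sB) s₀)

/-- The geometric generic point `Spec K̄ ⟶ B` of an integral scheme `B`, where `K̄` is an algebraic
closure of the function field `K` of `B`. -/
def geomGenericPoint (B : Scheme.{u}) [IsIntegral B] :
    Spec (.of (AlgebraicClosure B.functionField)) ⟶ B :=
  Spec.map (CommRingCat.ofHom
      (algebraMap B.functionField (AlgebraicClosure B.functionField))) ≫
    B.fromSpecStalk (genericPoint B)

/-- The geometric generic fiber `U ×_B K̄` is birational, over `K̄`, to `X₀ ×_k K̄`. -/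
def GeomGenericFiberBirational {k : Type u} [Field k] {U B X₀ : Scheme.{u}} [IsIntegral B]
    (sB : B ⟶ Spec (.of k)) (g : U ⟶ B) (s₀ : X₀ ⟶ Spec (.of k)) : Prop :=
  Scheme.BirationalOver
    (pullback.snd g (geomGenericPoint B))
    (pullback.snd s₀ (geomGenericPoint B ≫ sB))

/-- The family `g : U ⟶ B` is birationally isotrivial, with model `X₀`: both usual formulations
of this property are required. -/
structure IsBirationallyIsotrivial {k : Type u} [Field k] {U B X₀ : Scheme.{u}} [IsIntegral B]
    (sB : B ⟶ Spec (.of k)) (g : U ⟶ B) (s₀ : X₀ ⟶ Spec (.of k)) : Prop where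
  finiteCover : BirTrivialAfterFiniteCover sB g s₀
  geomGenericFiber : GeomGenericFiberBirational sB g s₀

end BirIsotrivial

end

/-! The geometric generic fibre looks, as an abstract scheme, like a fibre over a suitable closed
point. Shrink `B` to an affine open `Spec R` and let `Ω` be an algebraic closure of its fraction
field. The equations of `R`, of charts of `U` and of charts of `X₀` involve finitely many constants,
so they live over a field `F ⊆ k` finitely generated over the prime field. Since `trdeg F k` is
infinite and `Ω` has finite transcendence degree over `k`, the fields `Ω` and `k` have the same
transcendence degree over `F`, and there is an `F`-isomorphism `φ : Ω ≃ k`. It is not `k`-linear,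
but it carries the coordinates of the generic point to coordinates of a `k`-point `b`
(`exists_algHom_ringEquiv_agreeing`).

Base changes of finite type schemes depend birationally only on finitely many elements of the base
(`exists_finite_forall_birationalOver_of_ringEquiv`). Hence `φ` matches the geometric generic fibre
with the fibre over `b`, and `X₀ ×ₖ Ω` with `X₀`. The fibre over `b` is birational to `X₀` by
hypothesis, which gives (2) in `birationalOver_of_forall_algHom`.

For (1), a birational map over `Ω` is an isomorphism of localized algebras and involves finitely
many elements of `Ω`, all algebraic over `R`. After clearing denominators it is defined over `S =
R[1/r, Y]` with `Y` finite and integral over `R` (`exists_adjoin_birationalOver`), and `Spec S` is a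
finite cover of the open set `r ≠ 0`. -/

open scoped TensorProduct

/-! ### Transcendence degree, finite descent data and generic `k`-points. -/

/-- Two algebraically closed extensions of the same transcendence degree are isomorphic. -/
theorem IsAlgClosed.nonempty_algEquiv_of_trdeg_eq {F : Type u} {K L : Type u} [Field F] [Field K]
    [Field L] [Algebra F K] [Algebra F L] [IsAlgClosed K] [IsAlgClosed L]
    (h : Algebra.trdeg F K = Algebra.trdeg F L) : Nonempty (K ≃ₐ[F] L) := by
  obtain ⟨s, hs⟩ := exists_isTranscendenceBasis F K
  obtain ⟨t, ht⟩ := exists_isTranscendenceBasis F L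
  have hst : Cardinal.mk s = Cardinal.mk t := by
    rw [hs.cardinalMk_eq_trdeg, ht.cardinalMk_eq_trdeg, h]
  obtain ⟨e⟩ := Cardinal.eq.mp hst
  let := isAlgClosure_of_transcendence_basis _ hs
  let := isAlgClosure_of_transcendence_basis _ ht
  let ε : Algebra.adjoin F (Set.range ((↑) : s → K)) ≃ₐ[F]
      Algebra.adjoin F (Set.range ((↑) : t → L)) :=
    (hs.1.aevalEquiv.symm.trans (MvPolynomial.renameEquiv F e)).trans ht.1.aevalEquiv
  refine ⟨AlgEquiv.ofRingEquiv (f := IsAlgClosure.equivOfEquiv K L ε.toRingEquiv) fun x ↦ ?_⟩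
  rw [IsScalarTower.algebraMap_apply F (Algebra.adjoin F (Set.range ((↑) : s → K))) K,
    IsAlgClosure.equivOfEquiv_algebraMap]
  erw [ε.commutes]
  rfl

/-- Adjoining finitely many elements to a field leaves infinite transcendence degree infinite. -/
theorem Algebra.aleph0_le_trdeg_adjoin {F : Type u} {k : Type u} [Field F] [Field k] [Algebra F k]
    (hk : Cardinal.aleph0 ≤ Algebra.trdeg F k) {T : Set k} (hT : T.Finite) :
    Cardinal.aleph0 ≤ Algebra.trdeg (IntermediateField.adjoin F T) k := by
  have h := trdeg_add_eq F (IntermediateField.adjoin F T) (A := k)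
  rw [← h] at hk
  have hfin : Algebra.trdeg F (IntermediateField.adjoin F T) < Cardinal.aleph0 := by
    have : Algebra.EssFiniteType F (IntermediateField.adjoin F T) :=
      IntermediateField.essFiniteType_iff.mpr (IntermediateField.fg_adjoin_of_finite hT)
    exact trdeg_lt_aleph0 _ _
  by_contra! hlt
  exact absurd hk (not_le.mpr (Cardinal.add_lt_aleph0 hfin hlt))

/-- A finitely presented algebra with a marked element is determined by finitely many elements of
the base. -/
theorem Algebra.exists_finite_forall_tensorProduct_ringEquiv (R A : Type u) [CommRing R]
    [CommRing A] [Algebra R A] [Algebra.FinitePresentation R A] (f : A) :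
    ∃ T : Set R, T.Finite ∧ ∀ (Ω₁ Ω₂ : Type u) [CommRing Ω₁] [CommRing Ω₂] [Algebra R Ω₁]
      [Algebra R Ω₂] (φ : Ω₁ ≃+* Ω₂), (∀ t ∈ T, φ (algebraMap R Ω₁ t) = algebraMap R Ω₂ t) →
      ∃ e : Ω₁ ⊗[R] A ≃+* Ω₂ ⊗[R] A,
        (∀ x, e (x ⊗ₜ 1) = φ x ⊗ₜ 1) ∧ e (1 ⊗ₜ f) = 1 ⊗ₜ f := by
  let P := Algebra.Presentation.ofFinitePresentation R A
  obtain ⟨q, hq⟩ := P.aeval_val_surjective f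
  refine ⟨P.coeffs ∪ q.coeffs, P.finite_coeffs.union q.coeffs.finite_toSet, ?_⟩
  intro Ω₁ Ω₂ _ _ _ _ φ hφ
  -- `A` and `f` descend to a model `N` over `R₀`. The isomorphism `φ` need not respect `R`, but it
  -- is `R₀`-linear, so it acts on `Ω₁ ⊗[R₀] N`, which is `Ω₁ ⊗[R] A`.
  let R₀ : Subalgebra ℤ R := Algebra.adjoin ℤ (P.coeffs ∪ q.coeffs)
  have : P.HasCoeffs R₀ := ⟨fun x hx ↦ ⟨⟨x, Algebra.subset_adjoin (Or.inl hx)⟩, rfl⟩⟩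
  obtain ⟨q₀, hq₀⟩ : q ∈ Set.range (MvPolynomial.map (algebraMap R₀ R)) := by
    rw [MvPolynomial.mem_range_map_iff_coeffs_subset]
    exact fun x hx ↦ ⟨⟨x, Algebra.subset_adjoin (Or.inr hx)⟩, rfl⟩
  have hφ₀ : ∀ t : R₀, φ (algebraMap R₀ Ω₁ t) = algebraMap R₀ Ω₂ t := by
    rintro ⟨t, ht⟩
    change φ (algebraMap R Ω₁ t) = algebraMap R Ω₂ t
    induction ht using Algebra.adjoin_induction with
    | mem x hx => exact hφ x hx
    | algebraMap r => simp
    | add x y _ _ hx hy => simp [hx, hy]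
    | mul x y _ _ hx hy => simp [hx, hy]
  let N := P.ModelOfHasCoeffs R₀
  let _ : Algebra R₀ N := inferInstance
  let _ : Module R₀ N := Algebra.toModule
  let φ₀ : Ω₁ ≃ₐ[R₀] Ω₂ := AlgEquiv.ofRingEquiv (f := φ) hφ₀
  let α : R ⊗[R₀] N ≃ₐ[R] A := P.tensorModelOfHasCoeffsEquiv R₀
  let β (Ω : Type u) [CommRing Ω] [Algebra R Ω] :
      Ω ⊗[R] A ≃ₐ[Ω] Ω ⊗[R₀] N :=
    (Algebra.TensorProduct.congr AlgEquiv.refl α.symm).trans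
      (Algebra.TensorProduct.cancelBaseChange R₀ R Ω Ω N)
  have hβ (Ω : Type u) [CommRing Ω] [Algebra R Ω] :
      β Ω (1 ⊗ₜ f) = 1 ⊗ₜ Ideal.Quotient.mk _ q₀ := by
    have : α.symm f = 1 ⊗ₜ Ideal.Quotient.mk _ q₀ := by
      rw [AlgEquiv.symm_apply_eq]
      refine .trans ?_ (P.tensorModelOfHasCoeffsEquiv_tmul R₀ 1 q₀).symm
      rw [← hq, ← hq₀, MvPolynomial.aeval_map_algebraMap, map_one, one_mul]
    simp [β, this]
  refine ⟨((β Ω₁).toRingEquiv.trans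
    (Algebra.TensorProduct.congr φ₀ AlgEquiv.refl).toRingEquiv).trans (β Ω₂).symm.toRingEquiv,
    fun x ↦ ?_, ?_⟩
  · have h1 : β Ω₁ (x ⊗ₜ 1) = x ⊗ₜ 1 := (β Ω₁).commutes x
    have h2 : (β Ω₂).symm (φ x ⊗ₜ 1) = φ x ⊗ₜ 1 := (β Ω₂).symm.commutes (φ x)
    change (β Ω₂).symm ((Algebra.TensorProduct.congr φ₀ AlgEquiv.refl) (β Ω₁ (x ⊗ₜ 1))) = _
    rw [h1]
    exact h2
  · change (β Ω₂).symm ((Algebra.TensorProduct.congr φ₀ AlgEquiv.refl) (β Ω₁ (1 ⊗ₜ f))) = _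
    rw [AlgEquiv.symm_apply_eq, hβ, hβ]
    simp

/-- A generic point of `Spec R` with values in `k`, up to a finite amount of information. -/
theorem exists_algHom_ringEquiv_agreeing (k R Ω : Type u) [Field k] [IsAlgClosed k]
    (hk : Cardinal.aleph0 ≤ Algebra.trdeg (⊥ : Subfield k) k)
    [CommRing R] [IsDomain R] [Algebra k R] [Algebra.FiniteType k R] [Field Ω] [IsAlgClosed Ω]
    [Algebra R Ω] [FaithfulSMul R Ω] [Algebra.IsAlgebraic R Ω] (T : Set R) (hT : T.Finite) :
    ∃ (b : R →ₐ[k] k) (φ : Ω ≃+* k), ∀ t ∈ T, φ (algebraMap R Ω t) = b t := by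
  let : Algebra k Ω := ((algebraMap R Ω).comp (algebraMap k R)).toAlgebra
  have : IsScalarTower k R Ω := .of_algebraMap_eq' rfl
  have : Algebra.FinitePresentation k R := Algebra.FinitePresentation.of_finiteType.mp inferInstance
  let P := Algebra.Presentation.ofFinitePresentation k R
  choose q hq using P.aeval_val_surjective
  -- Constants that `φ` has to fix: those in the equations of `R`, and those in polynomials
  -- expressing the elements of `T` in the generators.
  let T₀ : Set k := P.coeffs ∪ ⋃ t ∈ T, (q t).coeffs
  have hT₀ : T₀.Finite := P.finite_coeffs.union (hT.biUnion fun t _ ↦ (q t).coeffs.finite_toSet)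
  let F := IntermediateField.adjoin (⊥ : Subfield k) T₀
  have hF : Cardinal.aleph0 ≤ Algebra.trdeg F k := Algebra.aleph0_le_trdeg_adjoin hk hT₀
  -- `Ω` adds only the finite transcendence degree of `R` over `k`, which an infinite cardinal
  -- absorbs.
  have htr : Algebra.trdeg F Ω = Algebra.trdeg F k := by
    rw [← trdeg_add_eq F k (A := Ω), ← trdeg_add_eq k R (A := Ω),
      trdeg_eq_zero (R := R) (A := Ω), add_zero]
    exact Cardinal.add_eq_left hF
      ((trdeg_lt_aleph0_of_finiteType (R := k) (S := R)).le.trans hF)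
  obtain ⟨φ⟩ := IsAlgClosed.nonempty_algEquiv_of_trdeg_eq htr
  have hφ : ∀ c ∈ T₀, φ (algebraMap k Ω c) = c := fun c hc ↦
    φ.commutes ⟨c, IntermediateField.subset_adjoin _ _ hc⟩
  -- Transported coordinates of the generic point. The relations have coefficients fixed by `φ`, so
  -- `v` satisfies them and defines a `k`-linear `b`.
  let v := fun i ↦ φ (algebraMap R Ω (P.val i))
  have key : ∀ p : MvPolynomial _ k, (p.coeffs : Set k) ⊆ T₀ →
      MvPolynomial.aeval v p = φ (algebraMap R Ω (MvPolynomial.aeval P.val p)) := by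
    intro p hp
    have : φ (algebraMap R Ω (MvPolynomial.aeval P.val p)) =
        MvPolynomial.eval₂ ((φ : Ω →+* k).comp (algebraMap k Ω)) v p := by
      rw [MvPolynomial.aeval_def, MvPolynomial.eval₂_comp_left (algebraMap R Ω),
        ← RingHom.coe_coe φ, MvPolynomial.eval₂_comp_left]
      rfl
    rw [this, MvPolynomial.aeval_def, MvPolynomial.eval₂_eq, MvPolynomial.eval₂_eq]
    refine Finset.sum_congr rfl fun d hd ↦ ?_
    congr 1
    exact (hφ _ (hp (MvPolynomial.coeff_mem_coeffs d (by simpa using hd)))).symm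
  have hker : ∀ a ∈ P.ker, MvPolynomial.aeval v a = 0 := by
    simp_rw [← RingHom.mem_ker, ← SetLike.le_def]
    rw [← P.span_range_relation_eq_ker, Ideal.span_le]
    rintro _ ⟨i, rfl⟩
    change MvPolynomial.aeval v _ = 0
    rw [key, P.aeval_val_relation, map_zero, map_zero]
    exact (P.coeffs_relation_subset_coeffs i).trans Set.subset_union_left
  let b : R →ₐ[k] k := (Ideal.Quotient.liftₐ P.ker (MvPolynomial.aeval v) hker).comp
    (P.quotientEquiv.restrictScalars k).symm.toAlgHom
  have hb : ∀ p : MvPolynomial _ k, b (MvPolynomial.aeval P.val p) = MvPolynomial.aeval v p := by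
    intro p
    have h : P.quotientEquiv.symm (MvPolynomial.aeval P.val p) = Ideal.Quotient.mk P.ker p := by
      rw [AlgEquiv.symm_apply_eq, P.quotientEquiv_mk]
      exact (P.algebraMap_apply p).symm
    change Ideal.Quotient.liftₐ P.ker (MvPolynomial.aeval v) hker
      (P.quotientEquiv.symm (MvPolynomial.aeval P.val p)) = _
    rw [h]
    rfl
  refine ⟨b, φ.toRingEquiv, fun t ht ↦ ?_⟩
  rw [← hq t, hb, key _ fun c hc ↦ Or.inr (Set.mem_biUnion ht hc)]
  rfl

/-! ### Descent of algebras and isomorphisms from `Ω` to finitely generated subalgebras. -/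

theorem Module.Flat.of_isDomain_of_field (S Ω : Type*) [CommRing S] [IsDomain S] [Field Ω]
    [Algebra S Ω] [FaithfulSMul S Ω] : Module.Flat S Ω := by
  let : Algebra (FractionRing S) Ω := FractionRing.liftAlgebra S Ω
  have : IsScalarTower S (FractionRing S) Ω := FractionRing.isScalarTower_liftAlgebra S Ω
  have : Module.Flat S (FractionRing S) := IsLocalization.flat (FractionRing S) (nonZeroDivisors S)
  exact Module.Flat.trans S (FractionRing S) Ω

section SpreadOut

variable {R Ω : Type u} [CommRing R] [Field Ω] [Algebra R Ω]

/-- The comparison map from the base change to a subalgebra `S` of `Ω` to the base change to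
`Ω`. -/
noncomputable def Subalgebra.tensorVal (S : Subalgebra R Ω) (A : Type u) [CommRing A]
    [Algebra R A] : S ⊗[R] A →ₐ[S] Ω ⊗[R] A :=
  Algebra.TensorProduct.map (Algebra.ofId S Ω) (AlgHom.id R A)

@[simp]
theorem Subalgebra.tensorVal_tmul (S : Subalgebra R Ω) (A : Type u) [CommRing A]
    [Algebra R A] (s : S) (a : A) : S.tensorVal A (s ⊗ₜ a) = (s : Ω) ⊗ₜ a := rfl

theorem Subalgebra.exists_finite_forall_mem_range_tensorVal {A : Type u} [CommRing A]
    [Algebra R A] (z : Ω ⊗[R] A) : ∃ X : Set Ω, X.Finite ∧ ∀ S : Subalgebra R Ω, X ⊆ S →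
      z ∈ (S.tensorVal A).range := by
  induction z with
  | zero => exact ⟨∅, Set.finite_empty, fun S _ ↦ zero_mem _⟩
  | tmul x a => exact ⟨{x}, Set.finite_singleton x, fun S hS ↦ ⟨⟨x, hS rfl⟩ ⊗ₜ a, rfl⟩⟩
  | add y z hy hz =>
    obtain ⟨X, hX, h⟩ := hy
    obtain ⟨Y, hY, h'⟩ := hz
    exact ⟨X ∪ Y, hX.union hY, fun S hS ↦ add_mem (h S (Set.subset_union_left.trans hS))
      (h' S (Set.subset_union_right.trans hS))⟩

/-- If no nonzero scalar killed `z`, then `s ↦ s • z` would be injective, and would stay so after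
tensoring with the flat `S`-module `Ω`. But then `1 ⊗ 1` goes to the image of `z` in `Ω ⊗[R] A`,
which is zero. -/
theorem Subalgebra.exists_smul_eq_zero_of_tensorVal_eq_zero (S : Subalgebra R Ω) {A : Type u}
    [CommRing A] [Algebra R A] (z : S ⊗[R] A) (hz : S.tensorVal A z = 0) :
    ∃ s : S, s ≠ 0 ∧ s • z = 0 := by
  by_contra! H
  have hinj : Function.Injective (LinearMap.toSpanSingleton S (S ⊗[R] A) z) := by
    rw [injective_iff_map_eq_zero]
    intro s hs
    by_contra hs'
    exact H s hs' hs
  have : Module.Flat S Ω := Module.Flat.of_isDomain_of_field S Ω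
  have h := Module.Flat.lTensor_preserves_injective_linearMap (M := Ω) _ hinj
  have h1 : LinearMap.lTensor Ω (LinearMap.toSpanSingleton S (S ⊗[R] A) z) (1 ⊗ₜ 1) = 0 := by
    simp only [LinearMap.lTensor_tmul, LinearMap.toSpanSingleton_apply, one_smul]
    apply (Algebra.TensorProduct.cancelBaseChange R S S Ω A).injective
    rw [map_zero, ← hz]
    clear hz h hinj H
    induction z with
    | zero => simp
    | tmul x a => simp [Algebra.smul_def]
    | add y z hy hz => rw [TensorProduct.tmul_add, map_add, map_add, hy, hz]
  have h2 : (1 : Ω) ⊗ₜ[S] (1 : S) = 0 := h (h1.trans (map_zero _).symm)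
  have h3 := congr(TensorProduct.rid S Ω $h2)
  simp at h3

/-- The kernel is a finitely generated ideal by Noetherianity. Each generator is killed by a nonzero
element of `S`, which divides a nonzero element of `R` by algebraicity; the product over the
generators serves for all. -/
theorem Subalgebra.exists_smul_ker_tensorVal_eq_zero [IsDomain R] [IsNoetherianRing R]
    [FaithfulSMul R Ω] [Algebra.IsAlgebraic R Ω] (S : Subalgebra R Ω) [Algebra.FiniteType R S]
    (A : Type u) [CommRing A] [Algebra R A] [Algebra.FiniteType R A] :
    ∃ r : R, r ≠ 0 ∧ ∀ z : S ⊗[R] A, S.tensorVal A z = 0 → r • z = 0 := by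
  have : Algebra.FiniteType R (S ⊗[R] A) := .trans (S := S) inferInstance inferInstance
  have : IsNoetherianRing (S ⊗[R] A) := Algebra.FiniteType.isNoetherianRing R _
  obtain ⟨t, ht⟩ := (isNoetherianRing_iff_ideal_fg _).mp this (RingHom.ker (S.tensorVal A))
  have hR : ∀ z : S ⊗[R] A, S.tensorVal A z = 0 → ∃ r : R, r ≠ 0 ∧ r • z = 0 := by
    intro z hz
    obtain ⟨s, hs, hsz⟩ := S.exists_smul_eq_zero_of_tensorVal_eq_zero z hz
    have hs' : IsAlgebraic R s :=
      (isAlgebraic_algebraMap_iff Subtype.val_injective).mp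
        (Algebra.IsAlgebraic.isAlgebraic (algebraMap S Ω s))
    obtain ⟨r, hr, c, hc⟩ := hs'.exists_nonzero_dvd (mem_nonZeroDivisors_of_ne_zero hs)
    refine ⟨r, hr, ?_⟩
    rw [← algebraMap_smul S r z, hc, mul_comm, mul_smul, hsz, smul_zero]
  choose! ρ hρ0 hρ using hR
  refine ⟨∏ z ∈ t, ρ z, Finset.prod_ne_zero_iff.mpr fun z hz ↦ hρ0 z ?_, fun z hz ↦ ?_⟩
  · exact (ht ▸ Ideal.subset_span hz : z ∈ RingHom.ker (S.tensorVal A))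
  · have hz' : z ∈ Ideal.span (t : Set (S ⊗[R] A)) := ht ▸ hz
    clear hz
    induction hz' using Submodule.span_induction with
    | zero => simp
    | add y z _ _ hy hz => rw [smul_add, hy, hz, add_zero]
    | smul a y _ hy => rw [smul_eq_mul, mul_comm, ← smul_mul_assoc, hy, zero_mul]
    | mem y hy =>
      obtain ⟨c, hc⟩ := Finset.dvd_prod_of_mem ρ hy
      rw [hc, mul_comm, mul_smul, hρ y (ht ▸ Ideal.subset_span hy :
        y ∈ RingHom.ker (S.tensorVal A)), smul_zero]

theorem Algebra.exists_pow_smul_mem_adjoin {r : R} (hr : algebraMap R Ω r ≠ 0) (X : Set Ω) {s : Ω}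
    (hs : s ∈ Algebra.adjoin R (insert (algebraMap R Ω r)⁻¹ X)) :
    ∃ n : ℕ, r ^ n • s ∈ Algebra.adjoin R X := by
  induction hs using Algebra.adjoin_induction with
  | mem x hx =>
    rcases hx with rfl | hx
    · exact ⟨1, by simp [Algebra.smul_def, hr]⟩
    · exact ⟨0, by simpa using Algebra.subset_adjoin hx⟩
  | algebraMap a => exact ⟨0, by simp⟩
  | add x y _ _ hx hy =>
    obtain ⟨n, hn⟩ := hx
    obtain ⟨m, hm⟩ := hy
    refine ⟨n + m, ?_⟩
    rw [smul_add, pow_add, mul_smul, mul_smul, smul_comm]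
    exact add_mem (Subalgebra.smul_mem _ hn _) (Subalgebra.smul_mem _ hm _)
  | mul x y _ _ hx hy =>
    obtain ⟨n, hn⟩ := hx
    obtain ⟨m, hm⟩ := hy
    refine ⟨n + m, ?_⟩
    rw [pow_add, ← smul_mul_smul_comm]
    exact mul_mem hn hm

theorem Subalgebra.tensorVal_map_inclusion {S₀ S : Subalgebra R Ω} (hle : S₀ ≤ S) (A : Type u)
    [CommRing A] [Algebra R A] (z : S₀ ⊗[R] A) :
    S.tensorVal A (Algebra.TensorProduct.map (Subalgebra.inclusion hle) (AlgHom.id R A) z) =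
      S₀.tensorVal A z := by
  induction z with
  | zero => rw [map_zero, map_zero, map_zero]
  | tmul x a => rw [Algebra.TensorProduct.map_tmul, tensorVal_tmul, tensorVal_tmul]; rfl
  | add y z hy hz => rw [map_add, map_add, map_add, hy, hz]

theorem Subalgebra.exists_pow_smul_eq_map_inclusion {S₀ S : Subalgebra R Ω} (hle : S₀ ≤ S) {r : R}
    (hS : ∀ s ∈ S, ∃ n : ℕ, r ^ n • s ∈ S₀) (A : Type u) [CommRing A] [Algebra R A]
    (z : S ⊗[R] A) : ∃ (n : ℕ) (w : S₀ ⊗[R] A), r ^ n • z =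
      Algebra.TensorProduct.map (Subalgebra.inclusion hle) (AlgHom.id R A) w := by
  induction z with
  | zero => exact ⟨0, 0, by rw [smul_zero, map_zero]⟩
  | tmul s a =>
    obtain ⟨n, ht⟩ := hS s.1 s.2
    refine ⟨n, ⟨_, ht⟩ ⊗ₜ a, ?_⟩
    have hs : r ^ n • s = Subalgebra.inclusion hle ⟨_, ht⟩ := Subtype.ext rfl
    rw [TensorProduct.smul_tmul', hs, Algebra.TensorProduct.map_tmul, AlgHom.id_apply]
  | add y z hy hz =>
    obtain ⟨n, t, hn⟩ := hy
    obtain ⟨m, u, hm⟩ := hz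
    refine ⟨n + m, r ^ m • t + r ^ n • u, ?_⟩
    rw [map_add, map_smul, map_smul, ← hn, ← hm, smul_add, smul_smul, smul_smul, ← pow_add,
      ← pow_add, add_comm m n]

/-- After inverting one element of the base, the comparison map becomes injective. -/
theorem Subalgebra.exists_forall_dvd_tensorVal_injective [IsDomain R] [IsNoetherianRing R]
    [FaithfulSMul R Ω] [Algebra.IsAlgebraic R Ω] {X : Set Ω} (hX : X.Finite)
    (A : Type u) [CommRing A] [Algebra R A] [Algebra.FiniteType R A] :
    ∃ r₀ : R, r₀ ≠ 0 ∧ ∀ r : R, r ≠ 0 → r₀ ∣ r → Function.Injective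
      ((Algebra.adjoin R (insert (algebraMap R Ω r)⁻¹ X)).tensorVal A) := by
  have : Algebra.FiniteType R (Algebra.adjoin R X) := .adjoin_of_finite hX
  obtain ⟨r₀, hr₀, h₀⟩ := (Algebra.adjoin R X).exists_smul_ker_tensorVal_eq_zero A
  refine ⟨r₀, hr₀, fun r hr hdvd ↦ ?_⟩
  have hr' : algebraMap R Ω r ≠ 0 := by simpa using hr
  have hle : Algebra.adjoin R X ≤ Algebra.adjoin R (insert (algebraMap R Ω r)⁻¹ X) :=
    Algebra.adjoin_mono (Set.subset_insert _ _)
  have hS : ∀ s ∈ Algebra.adjoin R (insert (algebraMap R Ω r)⁻¹ X),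
      ∃ n : ℕ, r ^ n • s ∈ Algebra.adjoin R X :=
    fun s hs ↦ Algebra.exists_pow_smul_mem_adjoin hr' X hs
  have hmem : (algebraMap R Ω r)⁻¹ ∈ Algebra.adjoin R (insert (algebraMap R Ω r)⁻¹ X) :=
    Algebra.subset_adjoin (Set.mem_insert _ _)
  generalize Algebra.adjoin R (insert (algebraMap R Ω r)⁻¹ X) = S at *
  generalize Algebra.adjoin R X = S₀ at *
  have hunit : ∀ z : S ⊗[R] A, r • z = 0 → z = 0 := by
    intro z hz
    have hi : (⟨_, hmem⟩ : S) * algebraMap R S r = 1 := Subtype.ext (inv_mul_cancel₀ hr')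
    rw [← one_smul S z, ← hi, mul_smul, algebraMap_smul, hz, smul_zero]
  have hunit' : ∀ (n : ℕ) (z : S ⊗[R] A), r ^ n • z = 0 → z = 0 := by
    intro n
    induction n with
    | zero => simp
    | succ n ih => exact fun z hz ↦ ih z (hunit _ (by rwa [smul_smul, ← pow_succ']))
  rw [injective_iff_map_eq_zero]
  intro z hz0
  -- A power of `r` brings `z` down to `S₀`, where `r₀` kills the kernel. Both `r` and its divisor
  -- `r₀` can be cancelled, as `r` is invertible in `S`.
  obtain ⟨n, w, hw⟩ := S₀.exists_pow_smul_eq_map_inclusion hle hS A z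
  have hw0 : S₀.tensorVal A w = 0 := by
    rw [← tensorVal_map_inclusion hle, ← hw, ← algebraMap_smul S (r ^ n) z, map_smul, hz0,
      smul_zero]
  obtain ⟨c, rfl⟩ := hdvd
  refine hunit' n z (hunit _ ?_)
  rw [hw, mul_comm, mul_smul, ← map_smul, h₀ w hw0, map_zero, smul_zero]

end SpreadOut

section SpreadOut

variable {R Ω : Type u} [CommRing R] [Field Ω] [Algebra R Ω]

theorem Set.Finite.exists_finite_forall_mem_range_tensorVal {A : Type u} [CommRing A]
    [Algebra R A] {Z : Set (Ω ⊗[R] A)} (hZ : Z.Finite) :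
    ∃ X : Set Ω, X.Finite ∧ ∀ S : Subalgebra R Ω, X ⊆ S → ∀ z ∈ Z, z ∈ (S.tensorVal A).range := by
  choose X hX h using Subalgebra.exists_finite_forall_mem_range_tensorVal (R := R) (Ω := Ω) (A := A)
  exact ⟨⋃ z ∈ Z, X z, hZ.biUnion fun z _ ↦ hX z, fun S hS z hz ↦
    h z S ((Set.subset_biUnion_of_mem hz).trans hS)⟩

set_option maxHeartbeats 1000000 in
/-- An algebra map `ψ` between localizations maps the localization of the model over `S` to the
localization of the model over `S` as soon as it does so on generators. -/
theorem Subalgebra.exists_finite_forall_map_range_awayMap_le {A A' : Type u} [CommRing A]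
    [CommRing A'] [Algebra R A] [Algebra.FiniteType R A] [Algebra R A']
    (f : Ω ⊗[R] A) (h : Ω ⊗[R] A')
    (ψ : Localization.Away f →ₐ[Ω] Localization.Away h) :
    ∃ X : Set Ω, X.Finite ∧ ∀ S : Subalgebra R Ω, X ⊆ S → ∀ (f₁ : S ⊗[R] A) (h₁ : S ⊗[R] A')
      [IsLocalization.Away (S.tensorVal A f₁) (Localization.Away f)]
      [IsLocalization.Away (S.tensorVal A' h₁) (Localization.Away h)],
      S.tensorVal A f₁ = f → S.tensorVal A' h₁ = h →
      ∀ x : Localization.Away f₁, ∃ y : Localization.Away h₁,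
        ψ (IsLocalization.Away.mapₐ _ (Localization.Away f) (S.tensorVal A) f₁ x) =
          IsLocalization.Away.mapₐ _ (Localization.Away h) (S.tensorVal A') h₁ y := by
  obtain ⟨g, hg⟩ := (inferInstance : Algebra.FiniteType R A).out
  have hsurj : ∀ x : Localization.Away h, ∃ (n : ℕ) (a : Ω ⊗[R] A'),
      x * algebraMap _ _ (h ^ n) = algebraMap _ (Localization.Away h) a := by
    intro x
    obtain ⟨⟨a, ⟨_, n, rfl⟩⟩, hx⟩ := IsLocalization.surj (Submonoid.powers h) x
    exact ⟨n, a, hx⟩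
  choose n num hnum using hsurj
  -- By `Ω`-linearity, `ψ` is controlled by its values on the inverse of `f` and on generators of
  -- `A`. It suffices that `S` contains the coefficients of their numerators.
  let Y : Set (Localization.Away h) := insert (ψ (IsLocalization.Away.invSelf f))
    ((fun a : A ↦ ψ (algebraMap _ _ ((1 : Ω) ⊗ₜ[R] a))) '' (g : Set A))
  have hY : Y.Finite := (g.finite_toSet.image _).insert _
  obtain ⟨X, hX, hXS⟩ := (hY.image num).exists_finite_forall_mem_range_tensorVal
  refine ⟨X, hX, fun S hS f₁ h₁ _ _ hf hh ↦ ?_⟩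
  let jf := IsLocalization.Away.mapₐ (Localization.Away f₁) (Localization.Away f) (S.tensorVal A) f₁
  let jh := IsLocalization.Away.mapₐ (Localization.Away h₁) (Localization.Away h)
    (S.tensorVal A') h₁
  have hjf (a : S ⊗[R] A) : jf (algebraMap _ _ a) = algebraMap _ _ (S.tensorVal A a) :=
    IsLocalization.map_eq (T := Submonoid.powers (S.tensorVal A f₁))
      (Submonoid.powers_le.mpr ⟨1, pow_one _⟩) a
  have hjh (a : S ⊗[R] A') : jh (algebraMap _ _ a) = algebraMap _ _ (S.tensorVal A' a) :=
    IsLocalization.map_eq (T := Submonoid.powers (S.tensorVal A' h₁))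
      (Submonoid.powers_le.mpr ⟨1, pow_one _⟩) a
  have hinvh : IsLocalization.Away.invSelf h ∈ jh.range := by
    refine ⟨IsLocalization.Away.invSelf h₁, ?_⟩
    change jh _ = _
    have h1 : jh (IsLocalization.Away.invSelf h₁) * algebraMap _ _ h = 1 := by
      have h3 : jh (algebraMap _ _ h₁) = algebraMap _ _ h := (hjh h₁).trans (congrArg _ hh)
      rw [← h3, ← map_mul, mul_comm, IsLocalization.Away.mul_invSelf]
      exact jh.toRingHom.map_one
    have h2 : algebraMap _ _ h * IsLocalization.Away.invSelf (S := Localization.Away h) h = 1 :=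
      IsLocalization.Away.mul_invSelf h
    rw [← mul_one (jh _), ← h2, ← mul_assoc, h1, one_mul]
  have hYr : ∀ y ∈ Y, y ∈ jh.range := by
    intro y hy
    obtain ⟨a, ha⟩ := hXS S hS _ ⟨y, hy, rfl⟩
    have ha' : S.tensorVal A' a = num y := ha
    have h2 : algebraMap _ _ h * IsLocalization.Away.invSelf (S := Localization.Away h) h = 1 :=
      IsLocalization.Away.mul_invSelf h
    have : y = algebraMap _ _ (num y) * IsLocalization.Away.invSelf h ^ n y := by
      rw [← hnum, map_pow, mul_assoc, ← mul_pow, h2, one_pow, mul_one]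
    rw [this, ← ha', ← hjh]
    exact mul_mem ⟨_, rfl⟩ (pow_mem hinvh _)
  have hfinv : ψ (IsLocalization.Away.invSelf f) ∈ jh.range := hYr _ (Set.mem_insert _ _)
  have hA : ∀ a : A, ψ (algebraMap _ _ ((1 : Ω) ⊗ₜ[R] a)) ∈ jh.range := by
    intro a
    have ha : a ∈ Algebra.adjoin R (g : Set A) := hg ▸ Algebra.mem_top
    induction ha using Algebra.adjoin_induction with
    | mem x hx => exact hYr _ (Set.mem_insert_of_mem _ ⟨x, hx, rfl⟩)
    | algebraMap r =>
      have h1 : (1 : Ω) ⊗ₜ[R] algebraMap R A r = algebraMap Ω _ (algebraMap R Ω r) := by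
        rw [Algebra.TensorProduct.algebraMap_apply, Algebra.algebraMap_eq_smul_one r,
          Algebra.algebraMap_eq_smul_one r, TensorProduct.tmul_smul, TensorProduct.smul_tmul']
        rfl
      rw [h1, ← IsScalarTower.algebraMap_apply, ψ.commutes]
      refine ⟨algebraMap S _ (algebraMap R S r), ?_⟩
      change jh _ = _
      rw [jh.commutes]
      rfl
    | add x y _ _ hx hy =>
      rw [TensorProduct.tmul_add, map_add, map_add]
      exact add_mem hx hy
    | mul x y _ _ hx hy =>
      rw [← one_mul (1 : Ω), ← Algebra.TensorProduct.tmul_mul_tmul, map_mul, map_mul]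
      exact mul_mem hx hy
  have hSA : ∀ z : S ⊗[R] A, ψ (algebraMap _ _ (S.tensorVal A z)) ∈ jh.range := by
    intro z
    induction z with
    | zero => rw [map_zero, map_zero, map_zero]; exact zero_mem _
    | tmul s a =>
      have h1 : S.tensorVal A (s ⊗ₜ a) = algebraMap Ω _ (s : Ω) * (1 ⊗ₜ a) := by
        rw [Subalgebra.tensorVal_tmul, Algebra.TensorProduct.algebraMap_apply,
          Algebra.TensorProduct.tmul_mul_tmul, mul_one, one_mul]
        rfl
      rw [h1, map_mul, map_mul, ← IsScalarTower.algebraMap_apply, ψ.commutes]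
      refine mul_mem ⟨algebraMap S _ s, ?_⟩ (hA a)
      change jh _ = _
      rw [jh.commutes]
      rfl
    | add y z hy hz => rw [map_add, map_add, map_add]; exact add_mem hy hz
  intro x
  obtain ⟨⟨a, ⟨_, m, rfl⟩⟩, hx⟩ := IsLocalization.surj (Submonoid.powers f₁) x
  have h2 : algebraMap _ _ f * IsLocalization.Away.invSelf (S := Localization.Away f) f = 1 :=
    IsLocalization.Away.mul_invSelf f
  have hx' : jf x = algebraMap _ _ (S.tensorVal A a) * IsLocalization.Away.invSelf f ^ m := by
    have h3 := congr(jf $hx)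
    rw [map_mul, hjf, hjf, map_pow, hf, map_pow] at h3
    rw [← h3, mul_assoc, ← mul_pow, h2, one_pow, mul_one]
  have hmem : ψ (jf x) ∈ jh.range := by
    rw [hx', map_mul, map_pow]
    exact mul_mem (hSA a) (pow_mem hfinv m)
  obtain ⟨y, hy⟩ := hmem
  exact ⟨y, hy.symm⟩

/-- An algebraic element becomes integral after multiplication by a nonzero element of `R`, and
inverting that element recovers it. Integrality of `Y` is what later makes the cover finite;
allowing all multiples of `r₀` lets one `r` meet several such conditions. -/
theorem Algebra.exists_finite_isIntegral_forall_dvd [IsDomain R] [Algebra.IsAlgebraic R Ω]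
    [FaithfulSMul R Ω] {X : Set Ω} (hX : X.Finite) :
    ∃ Y : Set Ω, Y.Finite ∧ (∀ y ∈ Y, IsIntegral R y) ∧ ∃ r₀ : R, r₀ ≠ 0 ∧ ∀ r : R, r ≠ 0 → r₀ ∣ r →
      X ⊆ Algebra.adjoin R (insert (algebraMap R Ω r)⁻¹ Y) := by
  obtain ⟨r₀, hr₀, h⟩ := Algebra.IsAlgebraic.exists_integral_multiples R hX.toFinset
  refine ⟨(fun x ↦ r₀ • x) '' X, hX.image _, ?_, r₀, hr₀, ?_⟩
  · rintro _ ⟨x, hx, rfl⟩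
    exact h x (hX.mem_toFinset.mpr hx)
  · rintro r hr ⟨c, rfl⟩ x hx
    have hr' : algebraMap R Ω (r₀ * c) ≠ 0 := by simpa using hr
    have : x = (algebraMap R Ω (r₀ * c))⁻¹ * (c • (r₀ • x)) := by
      rw [eq_inv_mul_iff_mul_eq₀ hr', smul_smul, mul_comm c, Algebra.smul_def]
    rw [this]
    have hY : r₀ • x ∈ (fun x ↦ r₀ • x) '' X := ⟨x, hx, rfl⟩
    exact mul_mem (Algebra.subset_adjoin (Set.mem_insert _ _)) (Subalgebra.smul_mem _
      (Algebra.subset_adjoin (Set.mem_insert_of_mem _ hY)) c)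

set_option maxHeartbeats 1000000 in
/-- An isomorphism between localizations of base changes to an algebraic field extension `Ω` of `R`
is defined over a finite extension of a localization of `R`. -/
theorem exists_adjoin_algEquiv_away [IsDomain R] [IsNoetherianRing R] [Algebra.IsAlgebraic R Ω]
    [FaithfulSMul R Ω] {A A' : Type u} [CommRing A] [CommRing A'] [Algebra R A]
    [Algebra.FiniteType R A] [Algebra R A'] [Algebra.FiniteType R A'] (A'' A''' : Type u)
    [CommRing A''] [Algebra R A''] [Algebra.FiniteType R A''] [CommRing A'''] [Algebra R A''']
    [Algebra.FiniteType R A'''] (f : Ω ⊗[R] A) (h : Ω ⊗[R] A')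
    (ψ : Localization.Away f ≃ₐ[Ω] Localization.Away h) :
    ∃ (Y : Set Ω) (r : R), Y.Finite ∧ (∀ y ∈ Y, IsIntegral R y) ∧ r ≠ 0 ∧
      ∀ S : Subalgebra R Ω, S = Algebra.adjoin R (insert (algebraMap R Ω r)⁻¹ Y) →
      Function.Injective (S.tensorVal A'') ∧ Function.Injective (S.tensorVal A''') ∧
      ∃ (f₁ : S ⊗[R] A) (h₁ : S ⊗[R] A'), S.tensorVal A f₁ = f ∧ S.tensorVal A' h₁ = h ∧
        Nonempty (Localization.Away f₁ ≃ₐ[S] Localization.Away h₁) := by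
  obtain ⟨X₁, hX₁, H₁⟩ := (Set.finite_singleton f).exists_finite_forall_mem_range_tensorVal
  obtain ⟨X₂, hX₂, H₂⟩ := (Set.finite_singleton h).exists_finite_forall_mem_range_tensorVal
  obtain ⟨X₃, hX₃, H₃⟩ :=
    Subalgebra.exists_finite_forall_map_range_awayMap_le f h ψ.toAlgHom
  obtain ⟨X₄, hX₄, H₄⟩ :=
    Subalgebra.exists_finite_forall_map_range_awayMap_le h f ψ.symm.toAlgHom
  obtain ⟨Y, hY, hYint, r₁, hr₁, HY⟩ := Algebra.exists_finite_isIntegral_forall_dvd (R := R)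
    (((hX₁.union hX₂).union hX₃).union hX₄)
  obtain ⟨r₂, hr₂, I₂⟩ := Subalgebra.exists_forall_dvd_tensorVal_injective (R := R) hY A
  obtain ⟨r₃, hr₃, I₃⟩ := Subalgebra.exists_forall_dvd_tensorVal_injective (R := R) hY A'
  -- `A''` and `A'''` are unrelated to `ψ`. They will be surjective charts of the two schemes, for
  -- which injectivity yields density statements over `S`.
  obtain ⟨r₄, hr₄, I₄⟩ := Subalgebra.exists_forall_dvd_tensorVal_injective (R := R) hY A''
  obtain ⟨r₅, hr₅, I₅⟩ := Subalgebra.exists_forall_dvd_tensorVal_injective (R := R) hY A'''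
  have hr : r₁ * r₂ * r₃ * r₄ * r₅ ≠ 0 :=
    mul_ne_zero (mul_ne_zero (mul_ne_zero (mul_ne_zero hr₁ hr₂) hr₃) hr₄) hr₅
  refine ⟨Y, r₁ * r₂ * r₃ * r₄ * r₅, hY, hYint, hr, ?_⟩
  intro S hS
  have h1 := HY _ hr ⟨r₂ * r₃ * r₄ * r₅, by ring⟩
  have h2 := I₂ _ hr ⟨r₁ * r₃ * r₄ * r₅, by ring⟩
  have h3 := I₃ _ hr ⟨r₁ * r₂ * r₄ * r₅, by ring⟩
  have h4 := I₄ _ hr ⟨r₁ * r₂ * r₃ * r₅, by ring⟩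
  have h5 := I₅ _ hr ⟨r₁ * r₂ * r₃ * r₄, by ring⟩
  rw [← hS] at h1 h2 h3 h4 h5
  obtain ⟨f₁, hf₁⟩ := H₁ S (fun x hx ↦ h1 (by simp [hx])) f rfl
  obtain ⟨h₁, hh₁⟩ := H₂ S (fun x hx ↦ h1 (by simp [hx])) h rfl
  replace hf₁ : S.tensorVal A f₁ = f := hf₁
  replace hh₁ : S.tensorVal A' h₁ = h := hh₁
  have : IsLocalization.Away (S.tensorVal A f₁) (Localization.Away f) := by
    rw [hf₁]; infer_instance
  have : IsLocalization.Away (S.tensorVal A' h₁) (Localization.Away h) := by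
    rw [hh₁]; infer_instance
  refine ⟨h4, h5, f₁, h₁, hf₁, hh₁, ?_⟩
  let jf := IsLocalization.Away.mapₐ (Localization.Away f₁) (Localization.Away f) (S.tensorVal A) f₁
  let jh := IsLocalization.Away.mapₐ (Localization.Away h₁) (Localization.Away h)
    (S.tensorVal A') h₁
  have hjf : Function.Injective jf := IsLocalization.Away.mapₐ_injective_of_injective f₁ h2
  have hjh : Function.Injective jh := IsLocalization.Away.mapₐ_injective_of_injective h₁ h3
  have e₁ : ∀ x, ψ (jf x) ∈ jh.range := fun x ↦ by
    obtain ⟨y, hy⟩ := H₃ S (fun x hx ↦ h1 (by simp [hx])) f₁ h₁ hf₁ hh₁ x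
    exact ⟨y, hy.symm⟩
  have e₂ : ∀ x, ψ.symm (jh x) ∈ jf.range := fun x ↦ by
    obtain ⟨y, hy⟩ := H₄ S (fun x hx ↦ h1 (by simp [hx])) h₁ f₁ hh₁ hf₁ x
    exact ⟨y, hy.symm⟩
  let Ψ : Localization.Away f →ₐ[S] Localization.Away h := ψ.toAlgHom.restrictScalars S
  -- `ψ` and its inverse both preserve the `S`-models inside the localizations over `Ω`, so `ψ`
  -- restricts to an isomorphism between them.
  let F : Localization.Away f₁ →ₐ[S] jh.range := (Ψ.comp jf).codRestrict jh.range e₁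
  refine ⟨(AlgEquiv.ofBijective F ⟨?_, ?_⟩).trans (AlgEquiv.ofInjective jh hjh).symm⟩
  · exact fun x y hxy ↦ hjf (ψ.injective congr(($hxy).1))
  · rintro ⟨_, y, rfl⟩
    obtain ⟨x, hx⟩ := e₂ y
    refine ⟨x, Subtype.ext ?_⟩
    change ψ (jf x) = jh y
    rw [← AlgEquiv.eq_symm_apply]
    exact hx

end SpreadOut

/-! ### Dense opens, generic points and dense affine opens. -/

section Topology

open TopologicalSpace

variable {X : Type*} [TopologicalSpace X]

/-- In a Noetherian space a component contains a nonempty open set. The dense open `O` meets it in a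
point that `x` specializes to, and opens are stable under generization. -/
theorem Dense.mem_of_closure_singleton_mem_irreducibleComponents [NoetherianSpace X] {O : Set X}
    (hO : IsOpen O) (hd : Dense O) {x : X} (hx : closure {x} ∈ irreducibleComponents X) :
    x ∈ O := by
  obtain ⟨o, ho, hne, hle⟩ :=
    NoetherianSpace.exists_isOpen_nonempty_subset_irreducibleComponent _ hx
  obtain ⟨z, hzo, hzO⟩ := hd.inter_open_nonempty o ho hne
  exact (specializes_iff_mem_closure.mpr (hle hzo)).mem_open hO hzO

theorem dense_of_forall_closure_singleton_mem_irreducibleComponents [QuasiSober X] {s : Set X}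
    (h : ∀ x, closure {x} ∈ irreducibleComponents X → x ∈ s) : Dense s := by
  intro y
  obtain ⟨g, hg⟩ := QuasiSober.sober (isIrreducible_irreducibleComponent (x := y))
    isClosed_irreducibleComponent
  have hg' : closure {g} = irreducibleComponent y := hg
  have hgs := h g (hg' ▸ irreducibleComponent_mem_irreducibleComponents y)
  exact closure_mono (Set.singleton_subset_iff.mpr hgs) (hg' ▸ mem_irreducibleComponent)

/-- The generic point of a component through `f x` lies in `O` and lifts to a generization of `x`,
which stays in every open neighbourhood of `x`. This is applied to flat morphisms. -/
theorem Dense.preimage_of_generalizingMap {Y : Type*} [TopologicalSpace Y] [NoetherianSpace Y]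
    [QuasiSober Y] {f : X → Y} (hf : GeneralizingMap f) {O : Set Y} (hO : IsOpen O)
    (hd : Dense O) : Dense (f ⁻¹' O) := by
  rw [dense_iff_inter_open]
  rintro W hW ⟨x, hx⟩
  obtain ⟨g, hg⟩ := QuasiSober.sober (isIrreducible_irreducibleComponent (x := f x))
    isClosed_irreducibleComponent
  have hg' : closure {g} = irreducibleComponent (f x) := hg
  have hgO : g ∈ O := hd.mem_of_closure_singleton_mem_irreducibleComponents hO
    (hg' ▸ irreducibleComponent_mem_irreducibleComponents (f x))
  have hgx : g ⤳ f x := specializes_iff_mem_closure.mpr (hg' ▸ mem_irreducibleComponent)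
  obtain ⟨x', hx', rfl⟩ := hf hgx
  exact ⟨x', hx'.mem_open hW hx, hgO⟩

end Topology

/-- Prime avoidance: the ideal of the complement of `O` lies in none of the finitely many minimal
primes, because `O` contains them all, so one `f` in it avoids them simultaneously. -/
theorem PrimeSpectrum.exists_basicOpen_le_dense {A : Type*} [CommRing A] [IsNoetherianRing A]
    {O : TopologicalSpace.Opens (PrimeSpectrum A)} (hO : Dense (O : Set (PrimeSpectrum A))) :
    ∃ f : A, PrimeSpectrum.basicOpen f ≤ O ∧
      Dense (PrimeSpectrum.basicOpen f : Set (PrimeSpectrum A)) := by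
  let I := PrimeSpectrum.vanishingIdeal (O : Set (PrimeSpectrum A))ᶜ
  have hI : PrimeSpectrum.zeroLocus (I : Set A) = (O : Set (PrimeSpectrum A))ᶜ := by
    rw [PrimeSpectrum.zeroLocus_vanishingIdeal_eq_closure, O.isOpen.isClosed_compl.closure_eq]
  have hfin := minimalPrimes.finite_of_isNoetherianRing A
  have hmin : ∀ x : PrimeSpectrum A, closure {x} ∈ irreducibleComponents (PrimeSpectrum A) ↔
      x.asIdeal ∈ minimalPrimes A := fun x ↦ by
    rw [← PrimeSpectrum.vanishingIdeal_mem_minimalPrimes, PrimeSpectrum.vanishingIdeal_singleton]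
  obtain ⟨f, hfI, hf⟩ : ∃ f ∈ I, ∀ p ∈ minimalPrimes A, f ∉ p := by
    by_contra! H
    have := (Ideal.subset_union_prime (s := hfin.toFinset) (f := id) (I := I) ⊤ ⊤
      (fun p hp _ _ ↦ (hfin.mem_toFinset.mp hp).1.1)).mp (fun f hf ↦ by
        obtain ⟨p, hp, hfp⟩ := H f hf
        simp only [Set.mem_iUnion]
        exact ⟨p, by simpa using hp, hfp⟩)
    obtain ⟨p, hp, hle⟩ := this
    have hp' := hfin.mem_toFinset.mp hp
    have hx : (⟨p, hp'.1.1⟩ : PrimeSpectrum A) ∈ O :=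
      hO.mem_of_closure_singleton_mem_irreducibleComponents O.2 ((hmin _).mpr hp')
    have hx' : (⟨p, hp'.1.1⟩ : PrimeSpectrum A) ∈ PrimeSpectrum.zeroLocus (I : Set A) := hle
    rw [hI] at hx'
    exact hx' hx
  refine ⟨f, fun x hx ↦ ?_, ?_⟩
  · by_contra hxO
    have : x ∈ PrimeSpectrum.zeroLocus (I : Set A) := hI ▸ hxO
    exact hx (this hfI)
  · exact dense_of_forall_closure_singleton_mem_irreducibleComponents fun x hx ↦
      hf _ ((hmin x).mp hx)

namespace AlgebraicGeometry

theorem Scheme.Hom.dense_preimage_of_flat {X Y : Scheme.{u}} (f : X ⟶ Y) [Flat f]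
    [TopologicalSpace.NoetherianSpace Y] {O : Y.Opens} (hO : Dense (O : Set Y)) :
    Dense (f ⁻¹ᵁ O : Set X) :=
  hO.preimage_of_generalizingMap (Flat.generalizingMap f) O.2

/-- `X` may be reducible. For each component take an affine open missing all the others; these are
disjoint and finite in number, so their union is affine, and it contains every generic point. -/
theorem Scheme.exists_isAffineOpen_dense (X : Scheme.{u}) [IsNoetherian X] :
    ∃ V : X.Opens, IsAffineOpen V ∧ Dense (V : Set X) := by
  have hfin : (irreducibleComponents X).Finite :=
    TopologicalSpace.NoetherianSpace.finite_irreducibleComponents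
  have key : ∀ Z ∈ irreducibleComponents X, ∃ V : X.Opens, IsAffineOpen V ∧
      (V : Set X).Nonempty ∧ (V : Set X) ⊆ (⋃₀ (irreducibleComponents X \ {Z}))ᶜ := by
    intro Z H
    have hZ := closure_sUnion_irreducibleComponents_sdiff_singleton hfin Z H
    have hopen : IsOpen (⋃₀ (irreducibleComponents X \ {Z}))ᶜ := by
      rw [Set.sUnion_eq_biUnion, isOpen_compl_iff]
      exact hfin.sdiff.isClosed_biUnion fun W hW ↦ isClosed_of_mem_irreducibleComponents W hW.1
    obtain ⟨x, hx⟩ : (⋃₀ (irreducibleComponents X \ {Z}))ᶜ.Nonempty := by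
      contrapose! hZ
      rw [hZ, closure_empty, ← Set.nonempty_iff_empty_ne]
      exact H.1.nonempty
    obtain ⟨V, hV, hxV, hle⟩ := exists_isAffineOpen_mem_and_subset
      (U := (⟨_, hopen⟩ : X.Opens)) hx
    exact ⟨V, hV, ⟨x, hxV⟩, hle⟩
  choose! V hV hne hle using key
  have hmem : ∀ Z W, W ∈ irreducibleComponents X → ∀ x ∈ (⋃₀ (irreducibleComponents X \ {Z}))ᶜ,
      x ∈ W → W = Z := by
    intro Z W hW x hx hxW
    by_contra hne
    exact hx ⟨W, ⟨hW, hne⟩, hxW⟩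
  refine ⟨⨆ Z ∈ irreducibleComponents X, V Z, .biSup_of_disjoint hfin hV ?_, ?_⟩
  · intro Z hZ W hW hZW
    rw [Function.onFun, ← TopologicalSpace.Opens.coe_disjoint, Set.disjoint_left]
    intro x hx hx'
    have h1 := hmem Z _ (irreducibleComponent_mem_irreducibleComponents x) x (hle Z hZ hx)
      mem_irreducibleComponent
    have h2 := hmem W _ (irreducibleComponent_mem_irreducibleComponents x) x (hle W hW hx')
      mem_irreducibleComponent
    exact hZW (h1.symm.trans h2)
  · refine dense_of_forall_closure_singleton_mem_irreducibleComponents fun x hx ↦ ?_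
    obtain ⟨y, hy⟩ := hne _ hx
    have h1 := hmem (closure {x}) _ (irreducibleComponent_mem_irreducibleComponents y) y
      (hle _ hx hy) mem_irreducibleComponent
    have hxy : x ⤳ y := specializes_iff_mem_closure.mpr (h1 ▸ mem_irreducibleComponent)
    have : x ∈ V (closure {x}) := hxy.mem_open (V _).2 hy
    simp only [TopologicalSpace.Opens.coe_iSup, Set.mem_iUnion]
    exact ⟨_, hx, this⟩

end AlgebraicGeometry

/-! ### Birational affine schemes and isomorphic localizations. -/

namespace AlgebraicGeometry

/-- The morphism of spectra induced by the structure map of an algebra. -/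
noncomputable abbrev specAlgebraMap (R A : Type u) [CommRing R] [CommRing A] [Algebra R A] :
    Spec (.of A) ⟶ Spec (.of R) :=
  Spec.map (CommRingCat.ofHom (algebraMap R A))

theorem specAlgebraMap_comp (R S A : Type u) [CommRing R] [CommRing S] [CommRing A] [Algebra R S]
    [Algebra S A] [Algebra R A] [IsScalarTower R S A] :
    specAlgebraMap S A ≫ specAlgebraMap R S = specAlgebraMap R A := by
  rw [specAlgebraMap, specAlgebraMap, ← Spec.map_comp, ← CommRingCat.ofHom_comp,
    ← IsScalarTower.algebraMap_eq]

theorem isOpenImmersion_specAlgebraMap_of_away (A : Type u) [CommRing A] (f : A) (L : Type u)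
    [CommRing L] [Algebra A L] [IsLocalization.Away f L] :
    IsOpenImmersion (specAlgebraMap A L) :=
  IsOpenImmersion.of_isLocalization f

theorem range_specAlgebraMap_of_away (A : Type u) [CommRing A] (f : A) (L : Type u)
    [CommRing L] [Algebra A L] [IsLocalization.Away f L] :
    Set.range (specAlgebraMap A L) = (PrimeSpectrum.basicOpen f : Set (PrimeSpectrum A)) :=
  PrimeSpectrum.localization_away_comap_range L f

theorem isDominant_specAlgebraMap_of_away {A : Type u} [CommRing A] {f : A}
    (hf : Dense (PrimeSpectrum.basicOpen f : Set (PrimeSpectrum A))) (L : Type u)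
    [CommRing L] [Algebra A L] [IsLocalization.Away f L] :
    IsDominant (specAlgebraMap A L) :=
  ⟨by rw [DenseRange, range_specAlgebraMap_of_away A f L]; exact hf⟩

/-- Restricted over `D(h)`, the open immersion becomes surjective, hence an isomorphism. -/
theorem bijective_awayMap_of_basicOpen_le {A B : Type u} [CommRing A] [CommRing B] (μ : A →+* B)
    [IsOpenImmersion (Spec.map (CommRingCat.ofHom μ))] (h : A)
    (hh : (PrimeSpectrum.basicOpen h : Set (PrimeSpectrum A)) ⊆
      Set.range (Spec.map (CommRingCat.ofHom μ))) :
    Function.Bijective (Localization.awayMap μ h) := by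
  let m := Spec.map (CommRingCat.ofHom μ)
  let ν := Spec.map (CommRingCat.ofHom (Localization.awayMap μ h))
  have hcomp : ν ≫ specAlgebraMap A (Localization.Away h) =
      specAlgebraMap B (Localization.Away (μ h)) ≫ m := by
    simp only [ν, m, specAlgebraMap, ← Spec.map_comp, ← CommRingCat.ofHom_comp]
    congr 2
    exact IsLocalization.map_comp _
  have := isOpenImmersion_specAlgebraMap_of_away A h (Localization.Away h)
  have := isOpenImmersion_specAlgebraMap_of_away B (μ h) (Localization.Away (μ h))
  have hν : IsOpenImmersion ν := by
    have : IsOpenImmersion (ν ≫ specAlgebraMap A (Localization.Away h)) := by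
      rw [hcomp]; infer_instance
    exact IsOpenImmersion.of_comp _ (specAlgebraMap A (Localization.Away h))
  have hsurj : Surjective ν := by
    constructor
    intro x
    have hx : specAlgebraMap A (Localization.Away h) x ∈
        (PrimeSpectrum.basicOpen h : Set (PrimeSpectrum A)) := by
      rw [← range_specAlgebraMap_of_away A h (Localization.Away h)]
      exact ⟨x, rfl⟩
    obtain ⟨y, hy⟩ := hh hx
    have hy' : y ∈ Set.range (specAlgebraMap B (Localization.Away (μ h))) := by
      rw [range_specAlgebraMap_of_away B (μ h)]
      have : m y ∈ (PrimeSpectrum.basicOpen h : Set (PrimeSpectrum A)) := by rw [hy]; exact hx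
      exact this
    obtain ⟨z, rfl⟩ := hy'
    refine ⟨z, (specAlgebraMap A (Localization.Away h)).isOpenEmbedding.injective ?_⟩
    rw [← hy, ← Scheme.Hom.comp_apply, ← Scheme.Hom.comp_apply, hcomp]
  have hiso : IsIso ν := (isIso_iff_isOpenImmersion_and_surjective ν).mpr ⟨hν, hsurj⟩
  exact isIso_SpecMap_iff.mp hiso

/-- Birational affine Noetherian schemes have isomorphic dense basic open subschemes. -/
theorem exists_algEquiv_away_of_birationalOver {K E E' : Type u} [CommRing K] [CommRing E]
    [CommRing E'] [Algebra K E] [Algebra K E'] [IsNoetherianRing E] [IsNoetherianRing E']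
    (H : Scheme.BirationalOver (specAlgebraMap K E) (specAlgebraMap K E')) :
    ∃ (f : E) (h : E'), Dense (PrimeSpectrum.basicOpen f : Set (PrimeSpectrum E)) ∧
      Dense (PrimeSpectrum.basicOpen h : Set (PrimeSpectrum E')) ∧
      Nonempty (Localization.Away f ≃ₐ[K] Localization.Away h) := by
  obtain ⟨F, hF⟩ := H
  obtain ⟨f₀, hf₀, hdense⟩ := PrimeSpectrum.exists_basicOpen_le_dense (O := F.source) F.dense_source
  let L := Localization.Away f₀
  have := isOpenImmersion_specAlgebraMap_of_away E f₀ L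
  have := isDominant_specAlgebraMap_of_away hdense L
  have hrange : Set.range (specAlgebraMap E L) ⊆ Set.range F.source.ι := by
    rw [range_specAlgebraMap_of_away E f₀ L, Scheme.Opens.range_ι]
    exact hf₀
  let a : Spec (.of L) ⟶ F.source := IsOpenImmersion.lift F.source.ι (specAlgebraMap E L) hrange
  have ha : a ≫ F.source.ι = specAlgebraMap E L := IsOpenImmersion.lift_fac _ _ _
  have : IsOpenImmersion a := by
    have : IsOpenImmersion (a ≫ F.source.ι) := ha ▸ inferInstance
    exact IsOpenImmersion.of_comp a F.source.ι
  have : IsDominant a := by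
    have : IsDominant (a ≫ F.source.ι) := ha ▸ inferInstance
    exact IsDominant.of_comp_of_isOpenImmersion a F.source.ι
  have := Opens.isDominant_ι F.dense_target
  let m : Spec (.of L) ⟶ Spec (.of E') := a ≫ F.iso.hom ≫ F.target.ι
  have hm : m ≫ specAlgebraMap K E' = specAlgebraMap K L := by
    simp only [m, Category.assoc]
    rw [hF, ← Category.assoc, ha, specAlgebraMap_comp]
  have : IsOpenImmersion m := inferInstance
  have : IsDominant m := inferInstance
  obtain ⟨h, hh, hhd⟩ := PrimeSpectrum.exists_basicOpen_le_dense (O := m.opensRange) m.denseRange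
  let μ : E' →ₐ[K] L :=
    { (Spec.preimage m).hom with
      commutes' := fun r ↦ by
        have h1 : CommRingCat.ofHom (algebraMap K E') ≫ Spec.preimage m =
            CommRingCat.ofHom (algebraMap K L) := Spec.map_injective (by
          rw [Spec.map_comp, Spec.map_preimage]; exact hm)
        exact congr($(h1).hom r) }
  have hμ : Spec.map (CommRingCat.ofHom (μ : E' →+* L)) = m := Spec.map_preimage m
  have : IsOpenImmersion (Spec.map (CommRingCat.ofHom (μ : E' →+* L))) := hμ ▸ inferInstance
  have hbij := bijective_awayMap_of_basicOpen_le (μ : E' →+* L) h (by rw [hμ]; exact hh)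
  -- `e` is a numerator of `μ h`, so inverting `μ h` in `L` amounts to inverting `f₀ * e` in `E`.
  let e := (IsLocalization.Away.sec f₀ (μ h)).1
  have : IsLocalization.Away (f₀ * e) (Localization.Away (μ h)) :=
    IsLocalization.Away.mul_of_associated f₀ e (μ h)
      (IsLocalization.Away.associated_sec_fst f₀ (μ h))
  refine ⟨f₀ * e, h, ?_, hhd, ⟨?_⟩⟩
  · have hd : Dense (PrimeSpectrum.basicOpen (μ h) : Set (PrimeSpectrum L)) := by
      have := hhd.preimage m.isOpenEmbedding.isOpenMap
      rw [← hμ] at this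
      exact this
    have := isDominant_specAlgebraMap_of_away hd (Localization.Away (μ h))
    have hdom : IsDominant (specAlgebraMap E (Localization.Away (μ h))) := by
      rw [← specAlgebraMap_comp E L]
      infer_instance
    rw [← range_specAlgebraMap_of_away E (f₀ * e) (Localization.Away (μ h))]
    exact hdom.1
  · let e₁ : Localization.Away (f₀ * e) ≃ₐ[K] Localization.Away (μ h) :=
      (IsLocalization.algEquiv (Submonoid.powers (f₀ * e)) _ _).restrictScalars K
    let e₂ : Localization.Away h ≃ₐ[K] Localization.Away (μ h) :=
      AlgEquiv.ofBijective (Localization.awayMapₐ μ h) hbij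
    exact e₁.trans e₂.symm

end AlgebraicGeometry

/-! ### Affine charts and their base change. -/

namespace AlgebraicGeometry

section Chart

variable {R A : Type u} [CommRing R] [CommRing A] [Algebra R A] {U : Scheme.{u}}
  {g : U ⟶ Spec (.of R)} {δ : Spec (.of A) ⟶ U} (hδ : δ ≫ g = specAlgebraMap R A)

/-- The base change of a chart `Spec A ⟶ U` over `Spec R` along `Spec Ω ⟶ Spec R`. -/
noncomputable def chartBaseChange (Ω : Type u) [CommRing Ω] [Algebra R Ω] :
    Spec (.of (Ω ⊗[R] A)) ⟶ pullback g (specAlgebraMap R Ω) :=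
  pullback.lift (Spec.map (CommRingCat.ofHom
      (Algebra.TensorProduct.includeRight : A →ₐ[R] Ω ⊗[R] A).toRingHom) ≫ δ)
    (specAlgebraMap Ω (Ω ⊗[R] A)) (by
      rw [Category.assoc, hδ, specAlgebraMap, specAlgebraMap, specAlgebraMap, ← Spec.map_comp,
        ← Spec.map_comp, ← CommRingCat.ofHom_comp, ← CommRingCat.ofHom_comp]
      congr 2
      exact (Algebra.TensorProduct.includeLeftRingHom_comp_algebraMap).symm)

theorem chartBaseChange_fst (Ω : Type u) [CommRing Ω] [Algebra R Ω] :
    chartBaseChange hδ Ω ≫ pullback.fst g (specAlgebraMap R Ω) =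
      Spec.map (CommRingCat.ofHom
        (Algebra.TensorProduct.includeRight : A →ₐ[R] Ω ⊗[R] A).toRingHom) ≫ δ :=
  pullback.lift_fst _ _ _

theorem chartBaseChange_snd (Ω : Type u) [CommRing Ω] [Algebra R Ω] :
    chartBaseChange hδ Ω ≫ pullback.snd g (specAlgebraMap R Ω) =
      specAlgebraMap Ω (Ω ⊗[R] A) :=
  pullback.lift_snd _ _ _

theorem isPullback_chartBaseChange (Ω : Type u) [CommRing Ω] [Algebra R Ω] :
    IsPullback (chartBaseChange hδ Ω) (Spec.map (CommRingCat.ofHom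
        (Algebra.TensorProduct.includeRight : A →ₐ[R] Ω ⊗[R] A).toRingHom))
      (pullback.fst g (specAlgebraMap R Ω)) δ := by
  refine (IsPullback.of_bot ?_ (chartBaseChange_fst hδ Ω).symm
    (IsPullback.of_hasPullback g (specAlgebraMap R Ω))).flip
  rw [chartBaseChange_snd, hδ]
  exact (isPullback_SpecMap_of_isPushout _ _ _ _
    (CommRingCat.isPushout_tensorProduct R Ω A)).flip

instance isOpenImmersion_chartBaseChange [IsOpenImmersion δ] (Ω : Type u) [CommRing Ω]
    [Algebra R Ω] : IsOpenImmersion (chartBaseChange hδ Ω) :=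
  MorphismProperty.of_isPullback (P := @IsOpenImmersion) (isPullback_chartBaseChange hδ Ω).flip ‹_›

instance surjective_chartBaseChange [Surjective δ] (Ω : Type u) [CommRing Ω]
    [Algebra R Ω] : Surjective (chartBaseChange hδ Ω) :=
  MorphismProperty.of_isPullback (P := @Surjective) (isPullback_chartBaseChange hδ Ω).flip ‹_›

theorem range_chartBaseChange (Ω : Type u) [CommRing Ω] [Algebra R Ω] :
    Set.range (chartBaseChange hδ Ω) =
      pullback.fst g (specAlgebraMap R Ω) ⁻¹' Set.range δ := by
  rw [← Scheme.Pullback.range_fst, ← (isPullback_chartBaseChange hδ Ω).isoPullback_hom_fst,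
    Scheme.Hom.comp_base, TopCat.coe_comp,
    (isPullback_chartBaseChange hδ Ω).isoPullback.hom.surjective.range_comp]

theorem isDominant_chartBaseChange_of_flat [IsOpenImmersion δ] [IsDominant δ]
    [TopologicalSpace.NoetherianSpace U] (Ω : Type u) [CommRing Ω] [Algebra R Ω]
    [Module.Flat R Ω] : IsDominant (chartBaseChange hδ Ω) := by
  have : Flat (specAlgebraMap R Ω) := Flat.SpecMap_iff.mpr (RingHom.flat_algebraMap_iff.mpr ‹_›)
  have h := (pullback.fst g (specAlgebraMap R Ω)).dense_preimage_of_flat (O := δ.opensRange)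
    δ.denseRange
  constructor
  rw [DenseRange, range_chartBaseChange]
  exact h

/-- The morphism between base changes induced by a tower of algebras. -/
noncomputable def baseChangeMap (g : U ⟶ Spec (.of R)) (S Ω : Type u) [CommRing S] [CommRing Ω]
    [Algebra R S] [Algebra R Ω] [Algebra S Ω] [IsScalarTower R S Ω] :
    pullback g (specAlgebraMap R Ω) ⟶ pullback g (specAlgebraMap R S) :=
  pullback.map _ _ _ _ (𝟙 U) (specAlgebraMap S Ω) (𝟙 _) (by simp)
    (by rw [specAlgebraMap_comp, Category.comp_id])

theorem chartBaseChange_comp_baseChangeMap (S Ω : Type u) [CommRing S] [CommRing Ω]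
    [Algebra R S] [Algebra R Ω] [Algebra S Ω] [IsScalarTower R S Ω] :
    chartBaseChange hδ Ω ≫ baseChangeMap g S Ω =
      Spec.map (CommRingCat.ofHom (Algebra.TensorProduct.map (Algebra.ofId S Ω)
        (AlgHom.id R A) : S ⊗[R] A →ₐ[S] Ω ⊗[R] A).toRingHom) ≫ chartBaseChange hδ S := by
  apply pullback.hom_ext
  · simp only [baseChangeMap, Category.assoc, pullback.lift_fst, pullback.map, Category.comp_id,
      chartBaseChange_fst, ← Spec.map_comp_assoc, ← CommRingCat.ofHom_comp]
    congr 3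
    ext a
    simp
  · simp only [baseChangeMap, Category.assoc, pullback.lift_snd, pullback.map,
      chartBaseChange_snd, reassoc_of% chartBaseChange_snd hδ, ← Spec.map_comp, ← CommRingCat.ofHom_comp]
    congr 2

end Chart

/-- A Noetherian scheme of finite type over `Spec R` has a dense affine chart. -/
theorem exists_chart_isDominant {R : Type u} [CommRing R] {U : Scheme.{u}} [IsNoetherian U]
    (g : U ⟶ Spec (.of R)) [LocallyOfFiniteType g] :
    ∃ (A : Type u) (_ : CommRing A) (_ : Algebra R A) (δ : Spec (.of A) ⟶ U),
      Algebra.FiniteType R A ∧ δ ≫ g = specAlgebraMap R A ∧ IsOpenImmersion δ ∧ IsDominant δ := by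
  obtain ⟨V, hV, hVd⟩ := U.exists_isAffineOpen_dense
  let φ := Spec.preimage (hV.fromSpec ≫ g)
  let _ : Algebra R Γ(U, V) := φ.hom.toAlgebra
  have hφ : hV.fromSpec ≫ g = specAlgebraMap R Γ(U, V) := (Spec.map_preimage _).symm
  refine ⟨Γ(U, V), inferInstance, inferInstance, hV.fromSpec, ?_, hφ, inferInstance, ?_⟩
  · have : LocallyOfFiniteType (specAlgebraMap R Γ(U, V)) := hφ ▸ inferInstance
    exact (HasRingHomProperty.Spec_iff (P := @LocallyOfFiniteType)).mp this
  · exact ⟨by rw [DenseRange, hV.range_fromSpec]; exact hVd⟩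

/-- A quasi-compact scheme of finite type over `Spec R` has a surjective affine chart. -/
theorem exists_chart_surjective {R : Type u} [CommRing R] {U : Scheme.{u}} [CompactSpace U]
    (g : U ⟶ Spec (.of R)) [LocallyOfFiniteType g] :
    ∃ (A : Type u) (_ : CommRing A) (_ : Algebra R A) (δ : Spec (.of A) ⟶ U),
      Algebra.FiniteType R A ∧ δ ≫ g = specAlgebraMap R A ∧ Surjective δ ∧ Flat δ := by
  let 𝒰 := U.affineCover.finiteSubcover
  have (i : 𝒰.I₀) : IsAffine (𝒰.X i) := Scheme.isAffine_affineCover U _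
  -- The disjoint union of a finite affine cover is one affine scheme. It is not open in `U` in
  -- general, but it sees every point and so can test density.
  let Y := ∐ 𝒰.X
  let y : Y ⟶ U := Sigma.desc 𝒰.f
  have hy : Surjective y := Surjective.sigmaDesc_of_union_range_eq_univ 𝒰.iUnion_range
  have : IsZariskiLocalAtSource @LocallyOfFiniteType.{u} :=
    HasRingHomProperty.instIsZariskiLocalAtSource (Q := RingHom.FiniteType)
  have hyl : LocallyOfFiniteType y :=
    IsZariskiLocalAtSource.sigmaDesc (P := @LocallyOfFiniteType) fun _ ↦ inferInstance
  have : IsZariskiLocalAtSource @Flat.{u} :=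
    HasRingHomProperty.instIsZariskiLocalAtSource (Q := RingHom.Flat)
  have hyf : Flat y := IsZariskiLocalAtSource.sigmaDesc (P := @Flat) fun _ ↦ inferInstance
  let φ := Spec.preimage (Y.isoSpec.inv ≫ y ≫ g)
  let _ : Algebra R Γ(Y, ⊤) := φ.hom.toAlgebra
  have hφ : Y.isoSpec.inv ≫ y ≫ g = specAlgebraMap R Γ(Y, ⊤) := (Spec.map_preimage _).symm
  refine ⟨Γ(Y, ⊤), inferInstance, inferInstance, Y.isoSpec.inv ≫ y, ?_, by simpa using hφ,
    inferInstance, inferInstance⟩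
  have : LocallyOfFiniteType (specAlgebraMap R Γ(Y, ⊤)) := hφ ▸ inferInstance
  exact (HasRingHomProperty.Spec_iff (P := @LocallyOfFiniteType)).mp this

end AlgebraicGeometry

/-! ### Transport of base changes along ring isomorphisms. -/

namespace AlgebraicGeometry

theorem Scheme.BirationalOver.comp {S S' X Y : Scheme.{u}} {sX : X ⟶ S} {sY : Y ⟶ S}
    (h : Scheme.BirationalOver sX sY) (t : S ⟶ S') :
    Scheme.BirationalOver (sX ≫ t) (sY ≫ t) := by
  obtain ⟨F, hF⟩ := h
  refine ⟨F, ?_⟩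
  rw [Scheme.PartialIso.IsOver, ← Category.assoc, ← Category.assoc, Category.assoc _ _ sY, hF,
    Category.assoc]

theorem Scheme.BirationalOver.of_iso {S X Y : Scheme.{u}} (e : X ≅ Y) {sX : X ⟶ S} {sY : Y ⟶ S}
    (h : e.hom ≫ sY = sX) : Scheme.BirationalOver sX sY :=
  Scheme.Hom.birationalOver e.hom sY sX h

theorem isNoetherian_of_locallyOfFiniteType {R : Type u} [CommRing R] [IsNoetherianRing R]
    {U : Scheme.{u}} (g : U ⟶ Spec (.of R)) [LocallyOfFiniteType g] [QuasiCompact g] :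
    IsNoetherian U where
  toIsLocallyNoetherian := LocallyOfFiniteType.isLocallyNoetherian g
  toCompactSpace := QuasiCompact.compactSpace_of_compactSpace g

/-- The base change of a scheme of finite type over `R` to a ring depends, up to birational
equivalence, only on the images of finitely many elements of `R`. -/
theorem exists_finite_forall_birationalOver_of_ringEquiv {R : Type u} [CommRing R]
    [IsNoetherianRing R] {U : Scheme.{u}} (g : U ⟶ Spec (.of R)) [LocallyOfFiniteType g]
    [QuasiCompact g] :
    ∃ T : Set R, T.Finite ∧ ∀ (Ω₁ Ω₂ : Type u) [CommRing Ω₁] [CommRing Ω₂] [Algebra R Ω₁]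
      [Algebra R Ω₂] [Module.Flat R Ω₁] (φ : Ω₁ ≃+* Ω₂),
      (∀ t ∈ T, φ (algebraMap R Ω₁ t) = algebraMap R Ω₂ t) →
      Scheme.BirationalOver (pullback.snd g (specAlgebraMap R Ω₁))
        (pullback.snd g (specAlgebraMap R Ω₂) ≫ Spec.map (CommRingCat.ofHom (φ : Ω₁ →+* Ω₂))) := by
  have := isNoetherian_of_locallyOfFiniteType g
  obtain ⟨A, _, _, δ, _, hδ, _, _⟩ := exists_chart_isDominant g
  obtain ⟨A', _, _, v, _, hv, _, _⟩ := exists_chart_surjective g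
  have : IsNoetherianRing A' := Algebra.FiniteType.isNoetherianRing R A'
  have : Algebra.FinitePresentation R A := Algebra.FinitePresentation.of_finiteType.mp ‹_›
  have : Algebra.FinitePresentation R A' := Algebra.FinitePresentation.of_finiteType.mp ‹_›
  obtain ⟨f, hfO, hfd⟩ := PrimeSpectrum.exists_basicOpen_le_dense (O := v ⁻¹ᵁ δ.opensRange)
    (v.dense_preimage_of_flat δ.denseRange)
  -- No marked element is needed for `A`; `0` is a filler.
  obtain ⟨T, hT, H⟩ := Algebra.exists_finite_forall_tensorProduct_ringEquiv R A 0
  obtain ⟨T', hT', H'⟩ := Algebra.exists_finite_forall_tensorProduct_ringEquiv R A' f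
  refine ⟨T ∪ T', hT.union hT', fun Ω₁ Ω₂ _ _ _ _ _ φ hφ ↦ ?_⟩
  obtain ⟨e, he, -⟩ := H Ω₁ Ω₂ φ fun t ht ↦ hφ t (Or.inl ht)
  obtain ⟨e', -, hef⟩ := H' Ω₁ Ω₂ φ fun t ht ↦ hφ t (Or.inr ht)
  have h₁ : IsDominant (chartBaseChange hδ Ω₁) := isDominant_chartBaseChange_of_flat hδ Ω₁
  -- `Ω₂` need not be flat over `R` (it will be `k` at a closed point), so density of the chart is
  -- not inherited from `U`. Instead `D(f)` is dense over the flat `Ω₁`, the isomorphism `e'` moves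
  -- this density to `Ω₂`, and the surjective chart `v` pushes it into the image of `δ`.
  have h₂ : IsDominant (chartBaseChange hδ Ω₂) := by
    have hd₁ : Dense (PrimeSpectrum.basicOpen ((1 : Ω₁) ⊗ₜ[R] f) :
        Set (PrimeSpectrum (Ω₁ ⊗[R] A'))) := by
      let p := Spec.map (CommRingCat.ofHom
        (Algebra.TensorProduct.includeRight : A' →ₐ[R] Ω₁ ⊗[R] A').toRingHom)
      have : Flat p := by
        have : Flat (specAlgebraMap R Ω₁) :=
          Flat.SpecMap_iff.mpr (RingHom.flat_algebraMap_iff.mpr ‹_›)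
        have hp := (isPullback_SpecMap_of_isPushout _ _ _ _
          (CommRingCat.isPushout_tensorProduct R Ω₁ A'))
        exact MorphismProperty.of_isPullback (P := @Flat) hp this
      exact p.dense_preimage_of_flat (O := PrimeSpectrum.basicOpen f) hfd
    have hd₂ : Dense (PrimeSpectrum.basicOpen ((1 : Ω₂) ⊗ₜ[R] f) :
        Set (PrimeSpectrum (Ω₂ ⊗[R] A'))) := by
      let p := Spec.map (CommRingCat.ofHom (e'.symm : Ω₂ ⊗[R] A' →+* Ω₁ ⊗[R] A'))
      have hp : IsIso p :=
        isIso_SpecMap_iff.mpr e'.symm.bijective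
      have h := hp.out
      have hd := p.denseRange.dense_image p.continuous hd₁
      refine hd.mono ?_
      rintro _ ⟨x, hx, rfl⟩
      change e'.symm (1 ⊗ₜ f) ∉ x.asIdeal
      rwa [← hef, e'.symm_apply_apply]
    have hd₃ := (chartBaseChange hv Ω₂).denseRange.dense_image
      (chartBaseChange hv Ω₂).continuous hd₂
    constructor
    refine hd₃.mono ?_
    rw [range_chartBaseChange]
    rintro _ ⟨x, hx, rfl⟩
    rw [Set.mem_preimage, ← Scheme.Hom.comp_apply, chartBaseChange_fst]
    exact hfO hx
  have b₁ := (Scheme.Hom.birationalOver (chartBaseChange hδ Ω₁) _ _ (chartBaseChange_snd hδ Ω₁))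
  have b₂ := (Scheme.Hom.birationalOver (chartBaseChange hδ Ω₂) _ _ (chartBaseChange_snd hδ Ω₂))
  refine b₁.symm.trans (Scheme.BirationalOver.trans ?_
    (b₂.comp (Spec.map (CommRingCat.ofHom (φ : Ω₁ →+* Ω₂)))))
  let p := Spec.map (CommRingCat.ofHom (e : Ω₁ ⊗[R] A →+* Ω₂ ⊗[R] A))
  have hp : IsIso p := isIso_SpecMap_iff.mpr e.bijective
  refine (Scheme.BirationalOver.of_iso (asIso p) ?_).symm
  simp only [asIso_hom, p, specAlgebraMap, ← Spec.map_comp, ← CommRingCat.ofHom_comp]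
  congr 2
  ext x
  exact he x

end AlgebraicGeometry

/-! ### Spreading out a birational equivalence. -/

namespace AlgebraicGeometry

theorem Scheme.BirationalOver.of_algEquiv {K E E' : Type u} [CommRing K] [CommRing E]
    [CommRing E'] [Algebra K E] [Algebra K E'] (e : E ≃ₐ[K] E') :
    Scheme.BirationalOver (specAlgebraMap K E) (specAlgebraMap K E') := by
  let p := Spec.map (CommRingCat.ofHom (e : E →+* E'))
  have hp : IsIso p := isIso_SpecMap_iff.mpr e.bijective
  refine (Scheme.BirationalOver.of_iso (asIso p) ?_).symm
  simp only [asIso_hom, p, specAlgebraMap, ← Spec.map_comp, ← CommRingCat.ofHom_comp]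
  congr 2
  ext x
  exact e.commutes x

/-- The image of `D(f)` contains that of `D(τ f)` under `β`, and a composite of dominant maps is
dominant. Density thus descends without flatness. -/
theorem isDominant_specAlgebraMap_away_comp {P P' : Type u} [CommRing P] [CommRing P']
    (τ : P →+* P') {f : P}
    (hf : Dense (PrimeSpectrum.basicOpen (τ f) : Set (PrimeSpectrum P'))) {V V' : Scheme.{u}}
    (c : Spec (.of P) ⟶ V) (c' : Spec (.of P') ⟶ V') (β : V' ⟶ V) [IsDominant c'] [IsDominant β]
    (h : c' ≫ β = Spec.map (CommRingCat.ofHom τ) ≫ c) :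
    IsDominant (specAlgebraMap P (Localization.Away f) ≫ c) := by
  have := isDominant_specAlgebraMap_of_away hf (Localization.Away (τ f))
  let m := Spec.map (CommRingCat.ofHom (Localization.awayMap τ f))
  have hm : m ≫ specAlgebraMap P _ = specAlgebraMap P' _ ≫ Spec.map (CommRingCat.ofHom τ) := by
    simp only [m, specAlgebraMap, ← Spec.map_comp, ← CommRingCat.ofHom_comp]
    congr 2
    exact IsLocalization.map_comp _
  have : IsDominant (m ≫ specAlgebraMap P (Localization.Away f) ≫ c) := by
    rw [reassoc_of% hm, ← h]
    infer_instance
  exact IsDominant.of_comp m _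

theorem specAlgebraMap_away_comp_chartBaseChange_snd {R A S : Type u} [CommRing R] [CommRing A]
    [CommRing S] [Algebra R A] [Algebra R S] {U : Scheme.{u}} {g : U ⟶ Spec (.of R)}
    {δ : Spec (.of A) ⟶ U} (hδ : δ ≫ g = specAlgebraMap R A) (f : S ⊗[R] A) :
    (specAlgebraMap (S ⊗[R] A) (Localization.Away f) ≫ chartBaseChange hδ S) ≫
      pullback.snd g (specAlgebraMap R S) = specAlgebraMap S (Localization.Away f) := by
  rw [Category.assoc, chartBaseChange_snd, specAlgebraMap_comp]

section SpreadOut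

variable {R S Ω : Type u} [CommRing R] [CommRing S] [CommRing Ω] [Algebra R S] [Algebra R Ω]
  [Algebra S Ω] [IsScalarTower R S Ω] {U U' : Scheme.{u}} {g : U ⟶ Spec (.of R)}
  {g' : U' ⟶ Spec (.of R)} {A A' : Type u} [CommRing A] [Algebra R A] [CommRing A'] [Algebra R A']
  {δ : Spec (.of A) ⟶ U} {δ' : Spec (.of A') ⟶ U'}

/-- An injective ring map is dominant on spectra, and the surjective chart carries this over to the
base changes of `U`. -/
theorem isDominant_baseChangeMap (hδ : δ ≫ g = specAlgebraMap R A) [Surjective δ]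
    (h : Function.Injective (Algebra.TensorProduct.map (Algebra.ofId S Ω) (AlgHom.id R A))) :
    IsDominant (baseChangeMap g S Ω) := by
  let τ := Algebra.TensorProduct.map (Algebra.ofId S Ω) (AlgHom.id R A)
  let m := Spec.map (CommRingCat.ofHom τ.toRingHom)
  have hm : IsDominant m := by
    constructor
    refine (PrimeSpectrum.denseRange_comap_iff_ker_le_nilRadical _).mpr ?_
    exact ((RingHom.injective_iff_ker_eq_bot τ.toRingHom).mp h).trans_le bot_le
  have : IsDominant (chartBaseChange hδ Ω ≫ baseChangeMap g S Ω) := by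
    rw [chartBaseChange_comp_baseChangeMap]
    exact inferInstanceAs (IsDominant (m ≫ chartBaseChange hδ S))
  exact IsDominant.of_comp (chartBaseChange hδ Ω) _

/-- `S` need not be flat over `R`, so density over `S` is deduced from density over `Ω`, where
flatness is available. -/
theorem birationalOver_localizationAway_of_isDominant (hδ : δ ≫ g = specAlgebraMap R A)
    [IsOpenImmersion δ] [IsDominant δ]
    [TopologicalSpace.NoetherianSpace U] [Module.Flat R Ω] (hS : IsDominant (baseChangeMap g S Ω))
    (f : S ⊗[R] A)
    (hf : Dense (PrimeSpectrum.basicOpen (Algebra.TensorProduct.map (Algebra.ofId S Ω)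
      (AlgHom.id R A) f) : Set (PrimeSpectrum (Ω ⊗[R] A)))) :
    Scheme.BirationalOver (specAlgebraMap S (Localization.Away f))
      (pullback.snd g (specAlgebraMap R S)) := by
  have := isOpenImmersion_specAlgebraMap_of_away (S ⊗[R] A) f (Localization.Away f)
  have := isDominant_chartBaseChange_of_flat hδ Ω
  let τ := Algebra.TensorProduct.map (Algebra.ofId S Ω) (AlgHom.id R A)
  have := isDominant_specAlgebraMap_away_comp τ.toRingHom hf (chartBaseChange hδ S)
    (chartBaseChange hδ Ω) _ (chartBaseChange_comp_baseChangeMap hδ S Ω)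
  exact Scheme.Hom.birationalOver
    (specAlgebraMap (S ⊗[R] A) (Localization.Away f) ≫ chartBaseChange hδ S) _ _
    (specAlgebraMap_away_comp_chartBaseChange_snd hδ f)

theorem birationalOver_of_algEquiv_away (hδ : δ ≫ g = specAlgebraMap R A)
    (hδ' : δ' ≫ g' = specAlgebraMap R A') [IsOpenImmersion δ] [IsDominant δ] [IsOpenImmersion δ']
    [IsDominant δ'] [TopologicalSpace.NoetherianSpace U] [TopologicalSpace.NoetherianSpace U']
    [Module.Flat R Ω] (hS : IsDominant (baseChangeMap g S Ω))
    (hS' : IsDominant (baseChangeMap g' S Ω)) (f : S ⊗[R] A) (h : S ⊗[R] A')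
    (hf : Dense (PrimeSpectrum.basicOpen (Algebra.TensorProduct.map (Algebra.ofId S Ω)
      (AlgHom.id R A) f) : Set (PrimeSpectrum (Ω ⊗[R] A))))
    (hh : Dense (PrimeSpectrum.basicOpen (Algebra.TensorProduct.map (Algebra.ofId S Ω)
      (AlgHom.id R A') h) : Set (PrimeSpectrum (Ω ⊗[R] A'))))
    (e : Localization.Away f ≃ₐ[S] Localization.Away h) :
    Scheme.BirationalOver (pullback.snd g (specAlgebraMap R S))
      (pullback.snd g' (specAlgebraMap R S)) :=
  (birationalOver_localizationAway_of_isDominant hδ hS f hf).symm.trans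
    ((Scheme.BirationalOver.of_algEquiv e).trans
      (birationalOver_localizationAway_of_isDominant hδ' hS' h hh))

end SpreadOut

/-- A birational equivalence between the base changes to an algebraic field extension `Ω` of `R`
is defined over a finite extension of a localization of `R`. -/
theorem exists_adjoin_birationalOver {R Ω : Type u} [CommRing R] [Field Ω] [Algebra R Ω]
    [IsDomain R] [IsNoetherianRing R] [Algebra.IsAlgebraic R Ω] [FaithfulSMul R Ω]
    {U U' : Scheme.{u}} (g : U ⟶ Spec (.of R)) (g' : U' ⟶ Spec (.of R))
    [LocallyOfFiniteType g] [QuasiCompact g] [LocallyOfFiniteType g'] [QuasiCompact g']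
    (H : Scheme.BirationalOver (pullback.snd g (specAlgebraMap R Ω))
      (pullback.snd g' (specAlgebraMap R Ω))) :
    ∃ (Y : Set Ω) (r : R), Y.Finite ∧ (∀ y ∈ Y, _root_.IsIntegral R y) ∧ r ≠ 0 ∧
      ∀ S : Subalgebra R Ω, S = Algebra.adjoin R (insert (algebraMap R Ω r)⁻¹ Y) →
      Scheme.BirationalOver (pullback.snd g (specAlgebraMap R S))
        (pullback.snd g' (specAlgebraMap R S)) := by
  have := isNoetherian_of_locallyOfFiniteType g
  have := isNoetherian_of_locallyOfFiniteType g'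
  have : Module.Flat R Ω := Module.Flat.of_isDomain_of_field R Ω
  obtain ⟨A, _, _, δ, _, hδ, _, _⟩ := exists_chart_isDominant g
  obtain ⟨A', _, _, δ', _, hδ', _, _⟩ := exists_chart_isDominant g'
  obtain ⟨C, _, _, v, _, hv, _, _⟩ := exists_chart_surjective g
  obtain ⟨C', _, _, v', _, hv', _, _⟩ := exists_chart_surjective g'
  have := isDominant_chartBaseChange_of_flat hδ Ω
  have := isDominant_chartBaseChange_of_flat hδ' Ω
  have : IsNoetherianRing (Ω ⊗[R] A) := Algebra.FiniteType.isNoetherianRing Ω _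
  have : IsNoetherianRing (Ω ⊗[R] A') := Algebra.FiniteType.isNoetherianRing Ω _
  have b := Scheme.Hom.birationalOver (chartBaseChange hδ Ω) _ _ (chartBaseChange_snd hδ Ω)
  have b' := Scheme.Hom.birationalOver (chartBaseChange hδ' Ω) _ _ (chartBaseChange_snd hδ' Ω)
  obtain ⟨f, h, hf, hh, ⟨ψ⟩⟩ := exists_algEquiv_away_of_birationalOver ((b.trans H).trans b'.symm)
  obtain ⟨Y, r, hY, hYint, hr, HS⟩ := exists_adjoin_algEquiv_away C C' f h ψ
  refine ⟨Y, r, hY, hYint, hr, fun S hS ↦ ?_⟩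
  obtain ⟨hC, hC', f₁, h₁, rfl, rfl, ⟨e⟩⟩ := HS S hS
  exact birationalOver_of_algEquiv_away hδ hδ' (isDominant_baseChangeMap hv hC)
    (isDominant_baseChangeMap hv' hC') f₁ h₁ hf hh e

end AlgebraicGeometry

/-! ### Isotriviality over an affine base. -/

namespace AlgebraicGeometry

section Isotrivial

variable {k R Ω : Type u} [Field k] [IsAlgClosed k] [CommRing R] [IsDomain R] [Algebra k R]
  [Algebra.FiniteType k R] [Field Ω] [IsAlgClosed Ω] [Algebra R Ω] [FaithfulSMul R Ω]
  [Algebra.IsAlgebraic R Ω] [Algebra k Ω] [IsScalarTower k R Ω] {U X₀ : Scheme.{u}}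
  (g : U ⟶ Spec (.of R)) [LocallyOfFiniteType g] [QuasiCompact g]
  (s₀ : X₀ ⟶ Spec (.of k)) [LocallyOfFiniteType s₀] [QuasiCompact s₀]

/-- If all fibres over rational points are birational to `X₀`, then so is the geometric generic
fibre: a rational point together with an isomorphism `Ω ≃+* k` can be chosen so that the fibre at
this point is the geometric generic fibre. -/
theorem birationalOver_of_forall_algHom (hk : Cardinal.aleph0 ≤ Algebra.trdeg (⊥ : Subfield k) k)
    (H : ∀ b : R →ₐ[k] k, Scheme.BirationalOver
      (pullback.snd g (Spec.map (CommRingCat.ofHom (b : R →+* k)))) s₀) :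
    Scheme.BirationalOver (pullback.snd g (specAlgebraMap R Ω))
      (pullback.snd s₀ (specAlgebraMap k Ω)) := by
  have : IsNoetherianRing R := Algebra.FiniteType.isNoetherianRing k R
  have : Module.Flat R Ω := Module.Flat.of_isDomain_of_field R Ω
  obtain ⟨T, hT, h⟩ := exists_finite_forall_birationalOver_of_ringEquiv g
  obtain ⟨T₀, hT₀, h₀⟩ := exists_finite_forall_birationalOver_of_ringEquiv s₀
  -- One pair `(b, φ)` must serve both `g` and `s₀`. On constants from `k`, agreeing with the
  -- `k`-linear `b` means being fixed by `φ`.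
  obtain ⟨b, φ, hφ⟩ := exists_algHom_ringEquiv_agreeing k R Ω hk _
    (hT.union (hT₀.image (algebraMap k R)))
  have h₁ : Scheme.BirationalOver (pullback.snd g (specAlgebraMap R Ω))
      (pullback.snd g (Spec.map (CommRingCat.ofHom (b : R →+* k))) ≫
        Spec.map (CommRingCat.ofHom (φ : Ω →+* k))) := by
    -- With `k` an `R`-algebra through `b`, base change to `k` is the fibre at `b`.
    let _ : Algebra R k := (b : R →+* k).toAlgebra
    exact h Ω k φ fun t ht ↦ hφ t (Or.inl ht)
  have h₂ := h₀ Ω k φ fun t ht ↦ by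
    rw [IsScalarTower.algebraMap_apply k R Ω, hφ _ (Or.inr ⟨t, ht, rfl⟩), b.commutes]
  have h₃ : Scheme.BirationalOver (pullback.snd s₀ (specAlgebraMap k k)) s₀ := by
    have hid : specAlgebraMap k k = 𝟙 _ := Spec.map_id _
    have : IsIso (pullback.fst s₀ (specAlgebraMap k k)) := by
      have : IsIso (specAlgebraMap k k) := by rw [hid]; infer_instance
      infer_instance
    refine Scheme.BirationalOver.of_iso (asIso (pullback.fst s₀ (specAlgebraMap k k))) ?_
    rw [asIso_hom, pullback.condition, hid, Category.comp_id]
  exact (h₁.trans ((H b).comp _)).trans ((h₃.comp _).symm.trans h₂.symm)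

/-- If all fibres over rational points are birational to `X₀`, then the family is birationally
trivial over a finite extension of a localization of the base ring. -/
theorem exists_adjoin_birationalOver_of_forall_algHom
    (hk : Cardinal.aleph0 ≤ Algebra.trdeg (⊥ : Subfield k) k)
    (H : ∀ b : R →ₐ[k] k, Scheme.BirationalOver
      (pullback.snd g (Spec.map (CommRingCat.ofHom (b : R →+* k)))) s₀) :
    ∃ (Y : Set Ω) (r : R), Y.Finite ∧ (∀ y ∈ Y, _root_.IsIntegral R y) ∧ r ≠ 0 ∧
      ∀ S : Subalgebra R Ω, S = Algebra.adjoin R (insert (algebraMap R Ω r)⁻¹ Y) →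
      Scheme.BirationalOver (pullback.snd g (specAlgebraMap R S))
        (pullback.snd s₀ (specAlgebraMap R S ≫ specAlgebraMap k R)) := by
  have : IsNoetherianRing R := Algebra.FiniteType.isNoetherianRing k R
  have key (S : Type u) [CommRing S] [Algebra R S] : Scheme.BirationalOver
      (pullback.snd (pullback.snd s₀ (specAlgebraMap k R)) (specAlgebraMap R S))
      (pullback.snd s₀ (specAlgebraMap R S ≫ specAlgebraMap k R)) :=
    Scheme.BirationalOver.of_iso (pullbackLeftPullbackSndIso _ _ _)
      (pullbackLeftPullbackSndIso_hom_snd _ _ _)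
  have hΩ := birationalOver_of_forall_algHom (Ω := Ω) g s₀ hk H
  rw [← specAlgebraMap_comp k R Ω] at hΩ
  obtain ⟨Y, r, hY, hYint, hr, hS⟩ := exists_adjoin_birationalOver (Ω := Ω) g
    (pullback.snd s₀ (specAlgebraMap k R)) (hΩ.trans (key Ω).symm)
  exact ⟨Y, r, hY, hYint, hr, fun S h ↦ (hS S h).trans (key S)⟩

end Isotrivial

end AlgebraicGeometry

/-! ### The finite cover and the passage to a general base. -/

/-- The subalgebra generated by `r⁻¹` and finitely many integral elements is finite over the
localization away from `r`, and the spectrum of this localization is covered. -/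
theorem exists_ringHom_localizationAway_adjoin {R Ω : Type u} [CommRing R] [IsDomain R] [Field Ω]
    [Algebra R Ω] [FaithfulSMul R Ω] {Y : Set Ω} (hY : Y.Finite) (hYint : ∀ y ∈ Y, IsIntegral R y)
    {r : R} (hr : r ≠ 0) (S : Subalgebra R Ω)
    (hS : S = Algebra.adjoin R (insert (algebraMap R Ω r)⁻¹ Y)) :
    ∃ l : Localization.Away r →+* S, l.comp (algebraMap R _) = algebraMap R S ∧ l.Finite ∧
      Function.Injective l := by
  have hr' : algebraMap R Ω r ≠ 0 := by simpa using hr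
  have hsub : insert (algebraMap R Ω r)⁻¹ Y ⊆ (S : Set Ω) := hS ▸ Algebra.subset_adjoin
  have hrS : (algebraMap R Ω r)⁻¹ ∈ S := hsub (Set.mem_insert _ _)
  have hu : IsUnit (algebraMap R S r) :=
    IsUnit.of_mul_eq_one ⟨_, hrS⟩ (Subtype.ext (mul_inv_cancel₀ hr'))
  let l : Localization.Away r →+* S := IsLocalization.Away.lift r hu
  have hl : l.comp (algebraMap R _) = algebraMap R S := IsLocalization.Away.lift_comp r hu
  have hft : Algebra.FiniteType R S :=
    (Subalgebra.fg_iff_finiteType S).mp ⟨(hY.insert _).toFinset, by rw [hS, Set.Finite.coe_toFinset]⟩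
  let _ : Algebra (Localization.Away r) S := l.toAlgebra
  have : IsScalarTower R (Localization.Away r) S := IsScalarTower.of_algebraMap_eq' hl.symm
  refine ⟨l, hl, ?_, ?_⟩
  · have hint : Algebra.IsIntegral (Localization.Away r) S := by
      refine ⟨fun x ↦ ?_⟩
      suffices ∀ y (_ : y ∈ Algebra.adjoin R (insert (algebraMap R Ω r)⁻¹ Y)) (hy : y ∈ S),
          IsIntegral (Localization.Away r) (⟨y, hy⟩ : S) from this x (hS ▸ x.2) x.2
      intro y hy
      induction hy using Algebra.adjoin_induction with
      | mem y hy =>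
        intro hyS
        obtain rfl | hy := hy
        · have : (⟨(algebraMap R Ω r)⁻¹, hyS⟩ : S) = algebraMap (Localization.Away r) S
              (IsLocalization.Away.invSelf r) := by
            refine hu.mul_left_cancel ?_
            rw [IsScalarTower.algebraMap_apply R (Localization.Away r) S, ← map_mul,
              IsLocalization.Away.mul_invSelf, map_one,
              ← IsScalarTower.algebraMap_apply R (Localization.Away r) S]
            exact Subtype.ext (mul_inv_cancel₀ hr')
          rw [this]
          exact isIntegral_algebraMap
        · exact ((isIntegral_algHom_iff S.val Subtype.val_injective (x := ⟨y, hyS⟩)).mp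
            (hYint y hy)).tower_top
      | algebraMap a => exact fun _ ↦ (isIntegral_algebraMap (R := R) (x := a) (A := S)).tower_top
      | add a b ha hb iha ihb =>
        rw [← hS] at ha hb
        exact fun _ ↦ (iha ha).add (ihb hb)
      | mul a b ha hb iha ihb =>
        rw [← hS] at ha hb
        exact fun _ ↦ (iha ha).mul (ihb hb)
    have : Algebra.FiniteType (Localization.Away r) S := .of_restrictScalars_finiteType R _ _
    exact Algebra.IsIntegral.finite
  · refine (injective_iff_map_eq_zero l).mpr fun x hx ↦ ?_
    obtain ⟨⟨a, s⟩, h⟩ := IsLocalization.surj (Submonoid.powers r) x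
    have h1 : l (algebraMap R _ a) = 0 := by rw [← h, map_mul, hx, zero_mul]
    have h2 : algebraMap R Ω a = 0 := congr(($((congr($hl a)).symm.trans h1) : Ω))
    have h3 : a = 0 := by simpa using h2
    rw [h3, map_zero] at h
    exact (IsLocalization.map_units _ s).mul_left_eq_zero.mp h

namespace AlgebraicGeometry

/-- The base change of `g` to a `k`-point of `B` is the fibre of `g` over a closed point. -/
theorem exists_isClosed_birationalOver_fiberStr {k : Type u} [Field k] [IsAlgClosed k]
    {U B : Scheme.{u}} (sB : B ⟶ Spec (.of k)) [LocallyOfFiniteType sB] (g : U ⟶ B)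
    (β : Spec (.of k) ⟶ B) (hβ : β ≫ sB = 𝟙 _) :
    ∃ b : B, IsClosed {b} ∧
      Scheme.BirationalOver (pullback.snd g β) (BirIsotrivial.fiberStr sB g b) := by
  let b := pointEquivClosedPoint sB ⟨β, hβ⟩
  have hb : Spec.map (residueFieldIsoBase sB b.1 b.2).hom ≫ B.fromSpecResidueField b.1 = β :=
    congr(($((pointEquivClosedPoint sB).symm_apply_apply ⟨β, hβ⟩)).1)
  refine ⟨b.1, b.2, ?_⟩
  let e : pullback g β ⟶ g.fiber b.1 := pullback.map _ _ _ _ (𝟙 U)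
    (Spec.map (residueFieldIsoBase sB b.1 b.2).hom) (𝟙 B) (by simp) (by rw [hb, Category.comp_id])
  have he : IsIso e := inferInstanceAs (IsIso (pullback.map _ _ _ _ _ _ _ _ _))
  refine Scheme.BirationalOver.of_iso (asIso e) ?_
  have h1 : e ≫ g.fiberι b.1 = pullback.fst g β :=
    (pullback.lift_fst _ _ _).trans (Category.comp_id _)
  rw [asIso_hom, BirIsotrivial.fiberStr, reassoc_of% h1, pullback.condition_assoc, hβ,
    Category.comp_id]

end AlgebraicGeometry

namespace BirIsotrivial

/-- A birational equivalence over a finite extension `S` of a localization of the coordinate ring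
of an affine open gives birational triviality after a finite cover. -/
theorem birTrivialAfterFiniteCover_of_adjoin {k R Ω : Type u} [Field k] [CommRing R] [IsDomain R]
    [Field Ω] [Algebra R Ω] [FaithfulSMul R Ω] {U B X₀ : Scheme.{u}} [IsIntegral B]
    (sB : B ⟶ Spec (.of k)) (g : U ⟶ B) (s₀ : X₀ ⟶ Spec (.of k)) (ι : Spec (.of R) ⟶ B)
    [IsOpenImmersion ι] {Y : Set Ω} (hY : Y.Finite) (hYint : ∀ y ∈ Y, _root_.IsIntegral R y)
    {r : R} (hr : r ≠ 0) (S : Subalgebra R Ω)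
    (hS : S = Algebra.adjoin R (insert (algebraMap R Ω r)⁻¹ Y))
    (H : ∀ (p : Spec (.of S) ⟶ B), p = specAlgebraMap R S ≫ ι →
      Scheme.BirationalOver (pullback.snd g p) (pullback.fst (p ≫ sB) s₀)) :
    BirTrivialAfterFiniteCover sB g s₀ := by
  obtain ⟨l, hl, hfin, hinj⟩ := exists_ringHom_localizationAway_adjoin hY hYint hr S hS
  have : IsDomain (Localization.Away r) := IsLocalization.isDomain_localization
    (Submonoid.powers_le.mpr (mem_nonZeroDivisors_of_ne_zero hr))
  have := isOpenImmersion_specAlgebraMap_of_away R r (Localization.Away r)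
  let j : Spec (.of (Localization.Away r)) ⟶ B := specAlgebraMap R (Localization.Away r) ≫ ι
  let m : Spec (.of S) ⟶ Spec (.of (Localization.Away r)) := Spec.map (CommRingCat.ofHom l)
  have hm : IsFinite m := (IsFinite.SpecMap_iff _).mpr hfin
  -- Lying over for the injective integral map `l`.
  have hms : Surjective m := ⟨hfin.to_isIntegral.comap_surjective hinj⟩
  have hp : (m ≫ j.isoOpensRange.hom) ≫ j.opensRange.ι = specAlgebraMap R S ≫ ι := by
    rw [Category.assoc, Scheme.Hom.isoOpensRange_hom_ι, ← Category.assoc]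
    congr 1
    simp only [m, specAlgebraMap, ← Spec.map_comp, ← CommRingCat.ofHom_comp, hl]
  refine ⟨j.opensRange, Spec (.of S), m ≫ j.isoOpensRange.hom, ?_, inferInstance, inferInstance,
    inferInstance, ?_⟩
  · exact j.opensRange.isOpen.dense (Set.range_nonempty j)
  · have h := H _ hp
    rw [Category.assoc] at h
    exact h

end BirIsotrivial

theorem corollary1p3 {k : Type u} [Field k] [IsAlgClosed k]
    (hk : Cardinal.aleph0 ≤ Algebra.trdeg (⊥ : Subfield k) k)
    {U B : Scheme.{u}} [IsIntegral B] (sB : B ⟶ Spec (.of k)) (hB : BirIsotrivial.IsVariety sB)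
    (g : U ⟶ B) (hg : BirIsotrivial.IsFamilyOfVarieties sB g)
    (hbir : ∀ b b' : B, IsClosed {b} → IsClosed {b'} →
      Scheme.BirationalOver (BirIsotrivial.fiberStr sB g b) (BirIsotrivial.fiberStr sB g b'))
    {X₀ : Scheme.{u}} (s₀ : X₀ ⟶ Spec (.of k)) (hX₀ : BirIsotrivial.IsVariety s₀)
    (hmodel : ∃ b : B, IsClosed {b} ∧
      Scheme.BirationalOver (BirIsotrivial.fiberStr sB g b) s₀) :
    BirIsotrivial.IsBirationallyIsotrivial sB g s₀ := by
  have := hB.locallyOfFiniteType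
  have := hg.locallyOfFiniteType
  have := hg.quasiCompact
  have := hX₀.locallyOfFiniteType
  have := hX₀.quasiCompact
  obtain ⟨b₀, hb₀, hbX⟩ := hmodel
  have hpoint (β : Spec (.of k) ⟶ B) (hβ : β ≫ sB = 𝟙 _) :
      Scheme.BirationalOver (pullback.snd g β) s₀ := by
    obtain ⟨b, hb, h⟩ := exists_isClosed_birationalOver_fiberStr sB g β hβ
    exact h.trans ((hbir b b₀ hb hb₀).trans hbX)
  -- An affine neighbourhood of the generic point is enough: it is dense in `B`, and `k(B)` is the
  -- fraction field of its coordinate ring.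
  obtain ⟨W, hW, hηW, -⟩ := exists_isAffineOpen_mem_and_subset (x := genericPoint B) (U := ⊤) trivial
  have : Nonempty W := ⟨⟨_, hηW⟩⟩
  let R : Type u := Γ(B, W)
  let K : Type u := B.functionField
  let Ω : Type u := AlgebraicClosure K
  have : IsFractionRing R K := functionField_isFractionRing_of_isAffineOpen B W hW
  let ι : Spec (.of R) ⟶ B := hW.fromSpec
  let φ := Spec.preimage (ι ≫ sB)
  let _ : Algebra k R := φ.hom.toAlgebra
  have hι : ι ≫ sB = specAlgebraMap k R := (Spec.map_preimage _).symm
  let _ : Algebra k Ω := ((algebraMap R Ω).comp (algebraMap k R)).toAlgebra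
  have : IsScalarTower k R Ω := IsScalarTower.of_algebraMap_eq' rfl
  have : Algebra.FiniteType k R := by
    have : LocallyOfFiniteType (specAlgebraMap k R) := hι ▸ inferInstance
    exact (HasRingHomProperty.Spec_iff (P := @LocallyOfFiniteType)).mp this
  have : Algebra.IsAlgebraic R Ω :=
    (IsFractionRing.comap_isAlgebraic_iff (A := R) (K := K) (C := Ω)).mpr inferInstance
  have : FaithfulSMul R Ω := by
    refine (faithfulSMul_iff_algebraMap_injective R Ω).mpr ?_
    rw [IsScalarTower.algebraMap_eq R K Ω]
    exact (algebraMap K Ω).injective.comp (IsFractionRing.injective R K)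
  have hgeom : BirIsotrivial.geomGenericPoint B = specAlgebraMap R Ω ≫ ι := by
    rw [BirIsotrivial.geomGenericPoint, ← hW.fromSpecStalk_eq_fromSpecStalk hηW,
      IsAffineOpen.fromSpecStalk, ← specAlgebraMap_comp R K Ω, Category.assoc]
    rfl
  let gW := pullback.snd g ι
  have key (S : Type u) [CommRing S] [Algebra R S] : Scheme.BirationalOver
      (pullback.snd g (specAlgebraMap R S ≫ ι)) (pullback.snd gW (specAlgebraMap R S)) :=
    (Scheme.BirationalOver.of_iso (pullbackLeftPullbackSndIso _ _ _)
      (pullbackLeftPullbackSndIso_hom_snd _ _ _)).symm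
  have H (b : R →ₐ[k] k) : Scheme.BirationalOver
      (pullback.snd gW (Spec.map (CommRingCat.ofHom (b : R →+* k)))) s₀ := by
    -- A `k`-algebra map `R → k` is a `k`-point of `B`, that is, a closed point, where the
    -- hypothesis on fibres applies.
    refine (Scheme.BirationalOver.of_iso (pullbackLeftPullbackSndIso _ _ _)
      (pullbackLeftPullbackSndIso_hom_snd _ _ _)).trans (hpoint _ ?_)
    rw [Category.assoc, hι, specAlgebraMap, ← Spec.map_comp, ← CommRingCat.ofHom_comp,
      b.comp_algebraMap]
    exact Spec.map_id _
  refine ⟨?_, ?_⟩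
  · obtain ⟨Y, r, hY, hYint, hr, hS⟩ :=
      exists_adjoin_birationalOver_of_forall_algHom (Ω := Ω) gW s₀ hk H
    refine BirIsotrivial.birTrivialAfterFiniteCover_of_adjoin sB g s₀ ι hY hYint hr _ rfl ?_
    rintro _ rfl
    refine ((key _).trans (hS _ rfl)).trans ?_
    rw [Category.assoc, hι]
    exact Scheme.BirationalOver.of_iso (pullbackSymmetry _ _) (pullbackSymmetry_hom_comp_fst _ _)
  · suffices ∀ p : Spec (.of Ω) ⟶ B, p = specAlgebraMap R Ω ≫ ι →
        Scheme.BirationalOver (pullback.snd g p) (pullback.snd s₀ (p ≫ sB)) from this _ hgeom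
    rintro _ rfl
    rw [Category.assoc, hι, specAlgebraMap_comp k R Ω]
    exact (key Ω).trans (birationalOver_of_forall_algHom gW s₀ hk H)
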